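/- Let $F$ be a non-Archimedean local field with ring of integers $\mathfrak{o}$, residue field $\kappa$ and $q=\#\kappa$; let $\pi$ be a uniformizer of $\mathfrak{o}$ and $\mathrm{ord}$ the normalized valuation of $F$. Let $$\phi(x)=x^n+c_1x^{n-1}+\cdots+c_{n-1}x+c_n\in\mathfrak{o}[x]$$ be a monic irreducible polynomial of degree $n\ge 4$ with $\mathrm{ord}(\phi(0))=2$, and suppose that $\mathrm{char}(F)=0$ or $\mathrm{char}(F)>n$. Let $E\cong F[x]/(\phi(x))$, with ring of integers $\mathcal{O}_E$ and uniformizer $\pi_E$, and let $R\cong\mathfrak{o}[x]/(\phi(x))$ be the corresponding order of $E$: a subring of $E$ that contains $\mathfrak{o}$, is isomorphic to $\mathfrak{o}[x]/(\phi(x))$ as an $\mathfrak{o}$-algebra, and spans $E$ over $F$. Let $X_R$ be the set of fractional $R$-ideals (finitely generated $R$-submodules $M$ of $E$ with $M\otimes_{\mathfrak{o}}F=E$), on which $\Lambda_E=\pi_E^{\mathbb{Z}}\subset E^\times$ acts by multiplication, and let $S(R)$ be the length of the $\mathfrak{o}$-module $\mathcal{O}_E/R$. When $n$ is even, put $$\phi_2(x)=x^2+\overline{c_{n/2}/\pi}\,x+\overline{c_n/\pi^2}\in\kappa[x],$$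 where the bar denotes reduction modulo $\pi$ (the quotients lie in $\mathfrak{o}$). Then $S(R)$ is finite, and $$\#(\Lambda_E\backslash X_R)=\begin{cases} q^{S(R)}+q^{S(R)-1}+\cdots+q^{S(R)-m} & \text{if } n=2m+1\ge 5,\\ q^{S(R)}+2\left(q^{S(R)-1}+\cdots+q^{S(R)-m}\right) & \text{if } n=2m\ge 4 \text{ and } \phi_2 \text{ is irreducible in } \kappa[x].\end{cases}$$ -/

import Mathlib

open Polynomial ValuativeRel
open scoped Pointwise

noncomputable section

namespace LocalOrbital

/-- The exact quotient `b / a` in a commutative ring: some `c` with `b = a * c` if `a ∣ b`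
(it is unique in a domain when `a ≠ 0`), and `0` otherwise. -/
def exactQuotient {A : Type*} [CommRing A] (b a : A) : A :=
  open Classical in if h : a ∣ b then h.choose else 0

section LocalField

variable (F : Type*) [Field F] [ValuativeRel F] [TopologicalSpace F]
  [IsNonarchimedeanLocalField F]

/-- The cardinality `q` of the residue field of `F`. -/
def residueCard : ℕ := Nat.card 𝓀[F]

variable {F}

/-- For `φ = x ^ n + c_1 x ^ (n-1) + ⋯ + c_n` with `n` even, the quadratic polynomial
`φ_2 = x ^ 2 + (c_{n/2} / ϖ mod ϖ) x + (c_n / ϖ ^ 2 mod ϖ)` over the residue field.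
Here `c_i` is the coefficient of `x ^ (n - i)`. -/
def phiTwo (ϖ : 𝒪[F]) (φ : 𝒪[F][X]) : 𝓀[F][X] :=
  X ^ 2
    + C (IsLocalRing.residue 𝒪[F]
        (exactQuotient (φ.coeff (φ.natDegree - φ.natDegree / 2)) ϖ)) * X
    + C (IsLocalRing.residue 𝒪[F] (exactQuotient (φ.coeff 0) (ϖ ^ 2)))

end LocalField

section Orders

variable {F : Type*} [Field F] [ValuativeRel F] [TopologicalSpace F]
  [IsNonarchimedeanLocalField F] {E : Type*} [Field E] [Algebra F E]

/-- The Serre invariant of `R`: the length of `𝒪_E / R` as an `𝒪_F`-module, where `𝒪_E` is the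
integral closure of `𝒪_F` in `E` (to be used for `R ⊆ 𝒪_E`). -/
def serreInvariant (R : Subalgebra 𝒪[F] E) : ℕ∞ :=
  Module.length 𝒪[F]
    (Subalgebra.toSubmodule (integralClosure 𝒪[F] E) ⧸
      (Subalgebra.toSubmodule R).submoduleOf (Subalgebra.toSubmodule (integralClosure 𝒪[F] E)))

/-- A fractional `R`-ideal: a finitely generated `R`-submodule `M` of `E` with `F M = E`.
(As `F` is a localization of `𝒪_F`, the map `M ⊗ F → E` is always injective, so that this says
`M ⊗ F = E`.) -/
def IsFractionalIdeal (R : Subalgebra 𝒪[F] E) (M : Submodule R E) : Prop :=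
  M.FG ∧ Submodule.span F (M : Set E) = ⊤

/-- The set `X_R` of fractional `R`-ideals with the multiplication action of `Eˣ`. -/
def fractionalIdeals (R : Subalgebra 𝒪[F] E) : SubMulAction Eˣ (Submodule R E) where
  carrier := {M | IsFractionalIdeal R M}
  smul_mem' u M hM := by
    refine ⟨hM.1.map _, eq_top_iff.2 fun x _ => ?_⟩
    have hx : (u : E)⁻¹ * x ∈ Submodule.span F (M : Set E) := hM.2 ▸ Submodule.mem_top
    have h := Submodule.mem_map_of_mem (f := LinearMap.mulLeft F (u : E)) hx
    rw [Submodule.map_span, LinearMap.mulLeft_apply, mul_inv_cancel_left₀ u.ne_zero] at h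
    exact h

/-- A uniformizer of `E`: a prime element of the ring of integers `𝒪_E`. -/
def IsUniformizer (F : Type*) [Field F] [ValuativeRel F] [TopologicalSpace F]
    [IsNonarchimedeanLocalField F] {E : Type*} [Field E] [Algebra F E] (πE : Eˣ) : Prop :=
  ∃ p : integralClosure 𝒪[F] E, Irreducible p ∧ (p : E) = πE

/-- The orbital integral `#(Λ_E \ X_R)`, with `Λ_E = πE ^ ℤ ⊆ Eˣ` acting on `X_R` by
multiplication (it is `0` if the set of orbits is infinite). -/
def orbitalIntegral (R : Subalgebra 𝒪[F] E) (πE : Eˣ) : ℕ :=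
  Nat.card (MulAction.orbitRel.Quotient (Subgroup.zpowers πE) (fractionalIdeals R))

end Orders

end LocalOrbital

end

/-! Write n = 2m + δ with δ ≤ 1. An irreducible polynomial over a complete field has a one-segment
Newton polygon, so ord(φ(0)) = 2 gives φ = ϖ² w + ϖ X^(m+δ) v + X^(2m+δ) with w(0) a unit. For a
root ξ with R = 𝔬[ξ], put t = ϖ / ξ^m. Dividing the equation by ξ^(2m) gives t² w(ξ) + t ξ^δ v(ξ) +
ξ^δ = 0, so t is integral over R and A = R + R t is an order.

If δ = 1, then ξ is a multiple of t and t generates the maximal ideal of A. If δ = 0 and φ₂ is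
irreducible, then ξ generates it and the residue of t has no value in κ. In both cases A is a
discrete valuation ring, so A = 𝒪_E. Moreover ξ^m A ⊆ R, the elements 1, t are a basis of A over R
modulo ξ^k A for every k ≤ m, and R modulo ξ^k A consists of the digit expansions in ξ of length k.
Hence A/R ≅ κ^m and S(R) = m (`IsDoubleOrder.length_quotient`).

Each Λ_E-orbit has exactly one member N contained in A and containing a unit u of A
(`orbitalIntegral_eq_card`). Rescaling u by a unit of R makes it 1 + b t, or b + t with b ∈ ξA.
Taking k least with ξ^k A ⊆ N, uniseriality of R modulo ξ^k A forces N = R u + ξ^k A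
(`IsDoubleOrder.exists_eq_lattice`), and only b modulo ξ^k matters. The first shape gives q^k
lattices for each 0 ≤ k ≤ m; the second gives q^(k-1) for each 1 ≤ k ≤ m, and occurs only if t is a
unit, that is, for δ = 0. -/

noncomputable section

namespace LocalOrbital

/-! ### Newton polygon of an irreducible polynomial -/

section Newton

/-- Over a complete nonarchimedean field, all roots of an irreducible polynomial have the same
norm, so that its Newton polygon is a segment. -/
theorem norm_coeff_pow_le_of_irreducible {K : Type*} [NontriviallyNormedField K]
    [IsUltrametricDist K] [CompleteSpace K] (p : K[X]) (hp : p.Monic) (hirr : Irreducible p)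
    (i : ℕ) (hi : i < p.natDegree) :
    ‖p.coeff i‖ ^ p.natDegree ≤ ‖p.coeff 0‖ ^ (p.natDegree - i) := by
  let L := AlgebraicClosure K
  have hsp : (p.map (algebraMap K L)).Splits := IsAlgClosed.splits _
  -- `p` is the minimal polynomial of each of its roots, and the spectral norm of a root is the
  -- spectral value of its minimal polynomial.
  have hmin : ∀ a ∈ (p.map (algebraMap K L)).roots,
      spectralMulAlgNorm K L a = spectralValue p := by
    intro a ha
    have ha' : aeval a p = 0 := by
      have := (mem_roots'.1 ha).2
      rwa [IsRoot.def, eval_map_algebraMap] at this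
    rw [spectralMulAlgNorm_def, spectralNorm, ← minpoly.eq_of_irreducible_of_monic hirr ha' hp]
  have hcard : (p.map (algebraMap K L)).roots.card = p.natDegree := by
    rw [← hsp.natDegree_eq_card_roots, natDegree_map]
  have h0 : ‖p.coeff 0‖ = spectralValue p ^ p.natDegree := by
    have h1 := hsp.coeff_zero_eq_prod_roots_of_monic (hp.map _)
    rw [coeff_map] at h1
    have h2 : ‖p.coeff 0‖ = spectralMulAlgNorm K L (algebraMap K L (p.coeff 0)) := by
      rw [spectralMulAlgNorm_def, spectralNorm_extends]
    rw [h2, h1, map_mul, map_pow, map_neg_eq_map, map_one, one_pow, one_mul, map_multiset_prod,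
      Multiset.map_congr rfl hmin, Multiset.map_const', Multiset.prod_replicate, hcard]
  have h3 : ‖p.coeff i‖ ^ (1 / ((p.natDegree : ℝ) - i)) ≤ spectralValue p := by
    rw [← spectralValueTerms_of_lt_natDegree p hi]
    exact le_ciSup (spectralValueTerms_bddAbove p) i
  have hpos : 0 < p.natDegree - i := by omega
  have h4 : ‖p.coeff i‖ ≤ spectralValue p ^ (p.natDegree - i) := by
    rw [← Nat.cast_sub hi.le, one_div] at h3
    calc ‖p.coeff i‖ = (‖p.coeff i‖ ^ ((p.natDegree - i : ℕ) : ℝ)⁻¹) ^ (p.natDegree - i) :=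
          (Real.rpow_inv_natCast_pow (norm_nonneg _) hpos.ne').symm
      _ ≤ _ := pow_le_pow_left₀ (by positivity) h3 _
  calc ‖p.coeff i‖ ^ p.natDegree ≤ (spectralValue p ^ (p.natDegree - i)) ^ p.natDegree :=
        pow_le_pow_left₀ (norm_nonneg _) h4 _
    _ = _ := by rw [h0, ← pow_mul, ← pow_mul, mul_comm]

variable {F : Type*} [Field F] [ValuativeRel F] [TopologicalSpace F]
  [IsNonarchimedeanLocalField F]

/-- Taking powers clears the fractional slope of the Newton polygon, so the norm inequality becomes
a divisibility in `𝒪[F]`. -/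
theorem coeff_zero_pow_dvd_coeff_pow (φ : 𝒪[F][X]) (hφ : φ.Monic) (hirr : Irreducible φ)
    (i : ℕ) (hi : i < φ.natDegree) :
    φ.coeff 0 ^ (φ.natDegree - i) ∣ φ.coeff i ^ φ.natDegree := by
  let := IsTopologicalAddGroup.rightUniformSpace F
  have := isUniformAddGroup_of_addCommGroup (G := F)
  -- A real-valued embedding of the value group turns the valuation into a norm.
  let : (Valued.v (R := F)).RankOne :=
  { hom' := IsRankLeOne.nonempty.some.emb (R := F).comp MonoidWithZeroHom.ValueGroup₀.embedding
    strictMono' := IsRankLeOne.nonempty.some.strictMono.comp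
        MonoidWithZeroHom.ValueGroup₀.embedding_strictMono }
  open scoped Valued in
  have h := norm_coeff_pow_le_of_irreducible (φ.map (algebraMap (valuation F).integer F)) (hφ.map _)
    ((hφ.irreducible_iff_irreducible_map_fraction_map).1 hirr) i (by rwa [hφ.natDegree_map])
  rw [hφ.natDegree_map, coeff_map, coeff_map, ← norm_pow, ← norm_pow, ← map_pow, ← map_pow,
    Valued.toNormedField.norm_le_iff] at h
  exact (Valuation.integer.integers (valuation F)).dvd_of_le h

/-- The two coefficient bounds that the Newton polygon gives when `ord (φ 0) = 2`. -/
theorem uniformizer_dvd_coeff {ϖ : 𝒪[F]} (hϖ : Irreducible ϖ) (φ : 𝒪[F][X]) (hφ : φ.Monic)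
    (hirr : Irreducible φ) (hord : IsDiscreteValuationRing.addVal 𝒪[F] (φ.coeff 0) = 2)
    (i : ℕ) (hi : i < φ.natDegree) :
    ϖ ∣ φ.coeff i ∧ (2 * i < φ.natDegree → ϖ ^ 2 ∣ φ.coeff i) := by
  have h := IsDiscreteValuationRing.addVal_le_iff_dvd.2 (coeff_zero_pow_dvd_coeff_pow φ hφ hirr i hi)
  rw [IsDiscreteValuationRing.addVal_pow, IsDiscreteValuationRing.addVal_pow, hord] at h
  have h1 : IsDiscreteValuationRing.addVal 𝒪[F] ϖ = 1 :=
    IsDiscreteValuationRing.addVal_uniformizer hϖ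
  rw [← IsDiscreteValuationRing.addVal_le_iff_dvd, ← IsDiscreteValuationRing.addVal_le_iff_dvd,
    IsDiscreteValuationRing.addVal_pow, h1]
  generalize IsDiscreteValuationRing.addVal 𝒪[F] (φ.coeff i) = a at h
  induction a using ENat.recTopCoe with
  | top => simp
  | coe a =>
    simp only [nsmul_eq_mul] at h ⊢
    norm_cast at h ⊢
    -- With a the order of the i-th coefficient, 2(n - i) ≤ n a. The left side is positive, and
    -- exceeds n when 2i < n.
    constructor
    · by_contra hc
      have : a = 0 := by omega
      subst this
      omega
    · intro h2
      by_contra hc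
      have : a ≤ 1 := by omega
      have : φ.natDegree * a ≤ φ.natDegree := by nlinarith
      omega

end Newton

/-! ### Lattices over an order R inside A = R + R t -/

section DoubleOrder

variable {O : Type*} [CommRing O] {E : Type*} [Field E] [Algebra O E]

/-- The fractional ideal `x ^ k A`. -/
def powIdeal (A : Subalgebra O E) (x : E) (k : ℕ) : Submodule A E :=
  Submodule.span A {x ^ k}

theorem mem_powIdeal {A : Subalgebra O E} {x e : E} {k : ℕ} :
    e ∈ powIdeal A x k ↔ ∃ a ∈ A, e = x ^ k * a := by
  rw [powIdeal, Submodule.mem_span_singleton]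
  constructor
  · rintro ⟨a, rfl⟩
    exact ⟨a, a.2, mul_comm _ _⟩
  · rintro ⟨a, ha, rfl⟩
    exact ⟨⟨a, ha⟩, mul_comm _ _⟩

theorem mul_mem_powIdeal {A : Subalgebra O E} {x e a : E} {k : ℕ} (ha : a ∈ A)
    (he : e ∈ powIdeal A x k) : a * e ∈ powIdeal A x k :=
  (powIdeal A x k).smul_mem ⟨a, ha⟩ he

theorem mem_powIdeal_zero {A : Subalgebra O E} {x e : E} : e ∈ powIdeal A x 0 ↔ e ∈ A := by
  simp [mem_powIdeal]

theorem mul_mem_powIdeal_succ {A : Subalgebra O E} {x e : E} {k : ℕ} (hx : x ≠ 0) :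
    x * e ∈ powIdeal A x (k + 1) ↔ e ∈ powIdeal A x k := by
  simp only [mem_powIdeal, pow_succ', mul_assoc, mul_right_inj' hx]

/-- A full rank `R`-lattice `R u + x ^ k A`. -/
def lattice {R A : Subalgebra O E} (hle : R ≤ A) (x u : E) (k : ℕ) : Submodule R E where
  carrier := {e | ∃ r ∈ R, e - r * u ∈ powIdeal A x k}
  add_mem' := by
    rintro a b ⟨r, hr, h⟩ ⟨s, hs, h'⟩
    refine ⟨r + s, add_mem hr hs, ?_⟩
    convert add_mem h h' using 1
    ring
  zero_mem' := ⟨0, zero_mem _, by simp⟩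
  smul_mem' := by
    rintro c e ⟨r, hr, h⟩
    refine ⟨c * r, mul_mem c.2 hr, ?_⟩
    convert mul_mem_powIdeal (hle c.2) h using 1
    rw [Subalgebra.smul_def, smul_eq_mul]
    ring

theorem mem_lattice {R A : Subalgebra O E} {hle : R ≤ A} {x u e : E} {k : ℕ} :
    e ∈ lattice hle x u k ↔ ∃ r ∈ R, e - r * u ∈ powIdeal A x k := Iff.rfl

theorem mul_mem_submodule {R : Subalgebra O E} {N : Submodule R E} {r e : E} (hr : r ∈ R)
    (he : e ∈ N) : r * e ∈ N :=
  N.smul_mem ⟨r, hr⟩ he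

theorem self_mem_lattice {R A : Subalgebra O E} (hle : R ≤ A) (x u : E) (k : ℕ) :
    u ∈ lattice hle x u k := ⟨1, one_mem _, by simp⟩

theorem powIdeal_mem_lattice {R A : Subalgebra O E} (hle : R ≤ A) {x e : E} (u : E) {k : ℕ}
    (he : e ∈ powIdeal A x k) : e ∈ lattice hle x u k := ⟨0, zero_mem _, by simpa using he⟩

theorem lattice_congr {R A : Subalgebra O E} (hle : R ≤ A) {x u v : E} {k : ℕ}
    (h : u - v ∈ powIdeal A x k) : lattice hle x u k = lattice hle x v k := by
  have key : ∀ u v : E, u - v ∈ powIdeal A x k → lattice hle x u k ≤ lattice hle x v k := by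
    rintro u v h e ⟨r, hr, he⟩
    refine ⟨r, hr, ?_⟩
    convert add_mem he (mul_mem_powIdeal (hle hr) h) using 1
    ring
  exact le_antisymm (key u v h) (key v u (by rw [← neg_sub]; exact neg_mem h))

variable [IsLocalRing O]

open IsLocalRing

/-- An order `R` in `A = R + R t` which is, modulo `x ^ m A`, generated by one element `x`. -/
structure IsDoubleOrder (R A : Subalgebra O E) (x t : E) (m : ℕ) : Prop where
  le : R ≤ A
  x_ne : x ≠ 0
  x_mem : x ∈ R
  t_mem : t ∈ A
  pow_mul_mem : x ^ m * t ∈ R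
  maximalIdeal_le : ∀ c ∈ maximalIdeal O, algebraMap O E c ∈ powIdeal A x m
  exists_eq_add : ∀ r ∈ R, ∃ c : O, ∃ r' ∈ R, r = algebraMap O E c + x * r'
  exists_eq_add_mul : ∀ a ∈ A, ∃ r ∈ R, ∃ s ∈ R, a = r + s * t
  mem_maximalIdeal : ∀ α β : O, algebraMap O E α + algebraMap O E β * t ∈ powIdeal A x 1 →
    α ∈ maximalIdeal O ∧ β ∈ maximalIdeal O
  inv_mem : ∀ c : O, ∀ r ∈ R, c ∉ maximalIdeal O → (algebraMap O E c + x * r)⁻¹ ∈ R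

namespace IsDoubleOrder

variable {R A : Subalgebra O E} {x t : E} {m : ℕ} (h : IsDoubleOrder R A x t m)

include h

theorem powIdeal_anti {j k : ℕ} (hjk : j ≤ k) : powIdeal A x k ≤ powIdeal A x j := by
  intro e he
  obtain ⟨a, ha, rfl⟩ := mem_powIdeal.1 he
  refine mem_powIdeal.2 ⟨x ^ (k - j) * a, mul_mem (pow_mem (h.le h.x_mem) _) ha, ?_⟩
  rw [← mul_assoc, ← pow_add, Nat.add_sub_cancel' hjk]

theorem mem_of_mem_powIdeal {e : E} {k : ℕ} (he : e ∈ powIdeal A x k) : e ∈ A :=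
  mem_powIdeal_zero.1 (h.powIdeal_anti (Nat.zero_le k) he)

theorem mem_maximalIdeal' {c : O} {r : E} (hr : r ∈ A)
    (hc : algebraMap O E c + x * r ∈ powIdeal A x 1) : c ∈ maximalIdeal O := by
  refine (h.mem_maximalIdeal c 0 ?_).1
  have := sub_mem hc (mem_powIdeal.2 ⟨r, hr, by rw [pow_one]⟩)
  simpa using this

theorem one_notMem {k : ℕ} (hk : 0 < k) : (1 : E) ∉ powIdeal A x k := by
  intro h1
  have h2 := h.mem_maximalIdeal' (c := 1) (zero_mem A) (by simpa using h.powIdeal_anti (Nat.succ_le_of_lt hk) h1)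
  exact (IsLocalRing.mem_maximalIdeal 1).1 h2 isUnit_one

theorem pow_notMem {j k : ℕ} (hjk : j < k) : x ^ j ∉ powIdeal A x k := by
  intro h1
  obtain ⟨a, ha, he⟩ := mem_powIdeal.1 h1
  refine h.one_notMem (Nat.sub_pos_of_lt hjk) (mem_powIdeal.2 ⟨a, ha, ?_⟩)
  apply mul_left_cancel₀ (pow_ne_zero j h.x_ne)
  rw [mul_one, ← mul_assoc, ← pow_add, Nat.add_sub_cancel' hjk.le]
  exact he

/-- Freeness of A on 1, t modulo x^k A. Independence modulo x puts both constant terms in the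
maximal ideal, hence in x^m A; they can be dropped, and what remains is divided by x. -/
theorem mem_powIdeal_of_add {k : ℕ} (hk : k ≤ m) {r s : E} (hr : r ∈ R) (hs : s ∈ R)
    (he : r + s * t ∈ powIdeal A x k) : r ∈ powIdeal A x k ∧ s ∈ powIdeal A x k := by
  induction k generalizing r s with
  | zero => exact ⟨mem_powIdeal_zero.2 (h.le hr), mem_powIdeal_zero.2 (h.le hs)⟩
  | succ k ih =>
    obtain ⟨c, p, hp, rfl⟩ := h.exists_eq_add _ hr
    obtain ⟨d, q, hq, rfl⟩ := h.exists_eq_add _ hs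
    have hrs : p + q * t ∈ A := add_mem (h.le hp) (mul_mem (h.le hq) h.t_mem)
    have h1 : algebraMap O E c + algebraMap O E d * t ∈ powIdeal A x 1 := by
      have := sub_mem (h.powIdeal_anti (Nat.le_add_left 1 k) he)
        (mem_powIdeal.2 ⟨p + q * t, hrs, rfl⟩)
      convert this using 1
      ring
    obtain ⟨hc, hd⟩ := h.mem_maximalIdeal _ _ h1
    have hc' := h.powIdeal_anti hk (h.maximalIdeal_le c hc)
    have hd' := h.powIdeal_anti hk (h.maximalIdeal_le d hd)
    have h2 : x * (p + q * t) ∈ powIdeal A x (k + 1) := by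
      have := sub_mem (sub_mem he hc') (mul_mem_powIdeal h.t_mem hd')
      convert this using 1
      ring
    obtain ⟨h3, h4⟩ := ih (by omega) hp hq ((mul_mem_powIdeal_succ h.x_ne).1 h2)
    exact ⟨add_mem hc' ((mul_mem_powIdeal_succ h.x_ne).2 h3),
      add_mem hd' ((mul_mem_powIdeal_succ h.x_ne).2 h4)⟩

/-- The conductor of R in A contains x^m A, since x^m multiplies both generators 1 and t into R. -/
theorem powIdeal_subset {e : E} (he : e ∈ powIdeal A x m) : e ∈ R := by
  obtain ⟨a, ha, rfl⟩ := mem_powIdeal.1 he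
  obtain ⟨r, hr, s, hs, rfl⟩ := h.exists_eq_add_mul _ ha
  have : x ^ m * (r + s * t) = x ^ m * r + s * (x ^ m * t) := by ring
  rw [this]
  exact add_mem (mul_mem (pow_mem h.x_mem _) hr) (mul_mem hs h.pow_mul_mem)

theorem ne_zero_of_notMem {c : O} {r : E} (hr : r ∈ A) (hc : c ∉ maximalIdeal O) :
    algebraMap O E c + x * r ≠ 0 := fun h0 =>
  hc (h.mem_maximalIdeal' hr (h0 ▸ zero_mem _))

/-- `R` is uniserial modulo `x ^ k A`. -/
theorem exists_unit_mul_pow {k : ℕ} (hk : k ≤ m) {r : E} (hr : r ∈ R) :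
    r ∈ powIdeal A x k ∨ ∃ j < k, ∃ ε ∈ R, ε ≠ 0 ∧ ε⁻¹ ∈ R ∧ r - x ^ j * ε ∈ powIdeal A x k := by
  induction k generalizing r with
  | zero => exact .inl (mem_powIdeal_zero.2 (h.le hr))
  | succ k ih =>
    obtain ⟨c, r', hr', rfl⟩ := h.exists_eq_add _ hr
    -- A constant term in the maximal ideal vanishes modulo x^m A and the exponent goes up by one;
    -- otherwise `r` is itself a unit.
    by_cases hc : c ∈ maximalIdeal O
    · have hc' := h.powIdeal_anti hk (h.maximalIdeal_le c hc)
      obtain h1 | ⟨j, hj, ε, hε, h0, hε', h1⟩ := ih (by omega) hr'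
      · exact .inl (add_mem hc' ((mul_mem_powIdeal_succ h.x_ne).2 h1))
      · refine .inr ⟨j + 1, by omega, ε, hε, h0, hε', ?_⟩
        convert add_mem hc' ((mul_mem_powIdeal_succ h.x_ne).2 h1) using 1
        ring
    · exact .inr ⟨0, by omega, _, hr, h.ne_zero_of_notMem (h.le hr') hc, h.inv_mem _ _ hr' hc,
        by simp⟩

omit h

/-- `u, u'` is a basis of `A` over `R` modulo every `x ^ k A` with `k ≤ m`. -/
structure IsBasisPair (R A : Subalgebra O E) (x : E) (m : ℕ) (u u' : E) : Prop where
  mem : u ∈ A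
  mem' : u' ∈ A
  exists_eq : ∀ a ∈ A, ∃ r ∈ R, ∃ s ∈ R, a = r * u + s * u'
  mem_of_add : ∀ k ≤ m, ∀ r ∈ R, ∀ s ∈ R, r * u + s * u' ∈ powIdeal A x k →
    r ∈ powIdeal A x k ∧ s ∈ powIdeal A x k

include h

theorem isBasisPair_one_add {b : E} (hb : b ∈ R) : IsBasisPair R A x m (1 + b * t) t where
  mem := add_mem (one_mem _) (mul_mem (h.le hb) h.t_mem)
  mem' := h.t_mem
  exists_eq a ha := by
    obtain ⟨r, hr, s, hs, rfl⟩ := h.exists_eq_add_mul a ha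
    exact ⟨r, hr, s - r * b, sub_mem hs (mul_mem hr hb), by ring⟩
  mem_of_add k hk r hr s hs he := by
    have h1 : r * (1 + b * t) + s * t = r + (r * b + s) * t := by ring
    rw [h1] at he
    obtain ⟨h2, h3⟩ := h.mem_powIdeal_of_add hk hr (add_mem (mul_mem hr hb) hs) he
    refine ⟨h2, ?_⟩
    have := sub_mem h3 (mul_mem_powIdeal (h.le hb) h2)
    convert this using 1
    ring

theorem isBasisPair_add {b : E} (hb : b ∈ R) : IsBasisPair R A x m (b + t) 1 where
  mem := add_mem (h.le hb) h.t_mem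
  mem' := one_mem _
  exists_eq a ha := by
    obtain ⟨r, hr, s, hs, rfl⟩ := h.exists_eq_add_mul a ha
    exact ⟨s, hs, r - s * b, sub_mem hr (mul_mem hs hb), by ring⟩
  mem_of_add k hk r hr s hs he := by
    have h1 : r * (b + t) + s * 1 = (r * b + s) + r * t := by ring
    rw [h1] at he
    obtain ⟨h3, h2⟩ := h.mem_powIdeal_of_add hk (add_mem (mul_mem hr hb) hs) hr he
    refine ⟨h2, ?_⟩
    have := sub_mem h3 (mul_mem_powIdeal (h.le hb) h2)
    convert this using 1
    ring

/-- The level k is an invariant: x^j u' lies in the second lattice, so its u'-coordinate x^j must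
vanish modulo x^k A. -/
theorem le_of_lattice_eq {u u' v : E} {j k : ℕ} (hu : IsBasisPair R A x m u u') (hk : k ≤ m)
    (he : lattice h.le x u k = lattice h.le x v j) : k ≤ j := by
  by_contra! hjk
  have h1 : x ^ j * u' ∈ lattice h.le x v j :=
    powIdeal_mem_lattice _ _ (mem_powIdeal.2 ⟨u', hu.mem', rfl⟩)
  rw [← he] at h1
  obtain ⟨r, hr, h2⟩ := mem_lattice.1 h1
  refine h.pow_notMem hjk (hu.mem_of_add k hk (-r) (neg_mem hr) (x ^ j) (pow_mem h.x_mem _) ?_).2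
  convert h2 using 1
  ring

/-- Choose k least with x^k A ⊆ N; such k ≤ m exists because u is a unit of A and x^m A ⊆ R. If r u
+ s u' ∈ N had s = x^j ε modulo x^k A with j < k, then N would contain x^j u', hence x^j A, against
minimality. -/
theorem exists_eq_lattice {u u' : E} (hu : IsBasisPair R A x m u u') (hinv : u⁻¹ ∈ A)
    (hu0 : u ≠ 0) {N : Submodule R E} (hN : ∀ e ∈ N, e ∈ A) (huN : u ∈ N) :
    ∃ k ≤ m, N = lattice h.le x u k := by
  classical
  have hm : ∀ e ∈ powIdeal A x m, e ∈ N := by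
    intro e he
    have h1 := mul_mem_submodule (h.powIdeal_subset (mul_mem_powIdeal hinv he)) huN
    rwa [mul_right_comm, inv_mul_cancel₀ hu0, one_mul] at h1
  have hex : ∃ k, ∀ e ∈ powIdeal A x k, e ∈ N := ⟨m, hm⟩
  let k := Nat.find hex
  have hk : ∀ e ∈ powIdeal A x k, e ∈ N := Nat.find_spec hex
  have hkm : k ≤ m := Nat.find_min' hex hm
  refine ⟨k, hkm, le_antisymm ?_ ?_⟩
  · intro y hy
    obtain ⟨r, hr, s, hs, rfl⟩ := hu.exists_eq y (hN y hy)
    refine mem_lattice.2 ⟨r, hr, ?_⟩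
    rw [add_sub_cancel_left, mul_comm]
    refine mul_mem_powIdeal hu.mem' ?_
    obtain h1 | ⟨j, hj, ε, hε, h0, hε', h1⟩ := h.exists_unit_mul_pow hkm hs
    · exact h1
    · refine absurd hj (not_lt.2 (Nat.find_min' hex fun e he => ?_))
      have h2 : s * u' ∈ N := by simpa using sub_mem hy (mul_mem_submodule hr huN)
      have h3 : x ^ j * u' ∈ N := by
        have h4 : (s - x ^ j * ε) * u' ∈ N := by
          rw [mul_comm]
          exact hk _ (mul_mem_powIdeal hu.mem' h1)
        have h5 := mul_mem_submodule hε' (sub_mem h2 h4)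
        convert h5 using 1
        field_simp
        ring
      obtain ⟨a, ha, rfl⟩ := mem_powIdeal.1 he
      obtain ⟨p, hp, q, hq, rfl⟩ := hu.exists_eq a ha
      have h6 := add_mem (mul_mem_submodule (mul_mem (pow_mem h.x_mem j) hp) huN)
        (mul_mem_submodule hq h3)
      convert h6 using 1
      ring
  · rintro e ⟨r, hr, he⟩
    simpa using add_mem (hk _ he) (mul_mem_submodule hr huN)

end IsDoubleOrder
end DoubleOrder

/-! ### Digit expansions and the two families of standard lattices -/

section DoubleOrder

variable {O : Type*} [CommRing O] [IsLocalRing O] {E : Type*} [Field E] [Algebra O E]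

open IsLocalRing

/-- A set-theoretic section of the residue map. -/
def residueLift (c : ResidueField O) : O :=
  Function.surjInv residue_surjective c

theorem residue_residueLift (c : ResidueField O) : residue O (residueLift c) = c :=
  Function.surjInv_eq residue_surjective c

/-- The polynomial in `x` of degree less than `k` with lifts of given residues as coefficients. -/
def digitSum (x : E) {k : ℕ} (b : Fin k → ResidueField O) : E :=
  ∑ i, algebraMap O E (residueLift (b i)) * x ^ (i : ℕ)

theorem digitSum_succ (x : E) {k : ℕ} (b : Fin (k + 1) → ResidueField O) :
    digitSum x b = algebraMap O E (residueLift (b 0)) + x * digitSum x (Fin.tail b) := by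
  rw [digitSum, digitSum, Fin.sum_univ_succ, Finset.mul_sum]
  simp only [Fin.val_zero, pow_zero, mul_one, Fin.val_succ, pow_succ', Fin.tail]
  congr 1
  exact Finset.sum_congr rfl fun i _ => by ring

namespace IsDoubleOrder

variable {R A : Subalgebra O E} {x t : E} {m : ℕ} (h : IsDoubleOrder R A x t m)

include h

theorem digitSum_mem {k : ℕ} (b : Fin k → ResidueField O) : digitSum x b ∈ R :=
  sum_mem fun _ _ => mul_mem (R.algebraMap_mem _) (pow_mem h.x_mem _)

theorem algebraMap_sub_mem {k : ℕ} (hk : k ≤ m) {c d : O} (hcd : residue O c = residue O d) :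
    algebraMap O E c - algebraMap O E d ∈ powIdeal A x k := by
  rw [← map_sub]
  refine h.powIdeal_anti hk (h.maximalIdeal_le _ ?_)
  rw [← residue_eq_zero_iff, map_sub, hcd, sub_self]

theorem exists_sub_digitSum_mem {k : ℕ} (hk : k ≤ m) {r : E} (hr : r ∈ R) :
    ∃ b : Fin k → ResidueField O, r - digitSum x b ∈ powIdeal A x k := by
  induction k generalizing r with
  | zero => exact ⟨fun i => i.elim0, mem_powIdeal_zero.2 (h.le (sub_mem hr (h.digitSum_mem _)))⟩
  | succ k ih =>
    obtain ⟨c, r', hr', rfl⟩ := h.exists_eq_add _ hr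
    obtain ⟨b, hb⟩ := ih (by omega) hr'
    refine ⟨Fin.cons (residue O c) b, ?_⟩
    rw [digitSum_succ, Fin.cons_zero, Fin.tail_cons]
    have h1 := h.algebraMap_sub_mem hk (residue_residueLift (residue O c)).symm
    convert add_mem h1 ((mul_mem_powIdeal_succ h.x_ne).2 hb) using 1
    ring

/-- With `exists_sub_digitSum_mem`, this identifies R modulo x^k A with the digit strings of length
k. -/
theorem digitSum_injective {k : ℕ} (hk : k ≤ m) {b b' : Fin k → ResidueField O}
    (hb : digitSum x b - digitSum x b' ∈ powIdeal A x k) : b = b' := by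
  induction k with
  | zero => exact Subsingleton.elim _ _
  | succ k ih =>
    rw [digitSum_succ, digitSum_succ] at hb
    have h0 : b 0 = b' 0 := by
      rw [← residue_residueLift (b 0), ← residue_residueLift (b' 0), ← sub_eq_zero, ← map_sub,
        residue_eq_zero_iff]
      refine h.mem_maximalIdeal' (sub_mem (h.le (h.digitSum_mem (Fin.tail b)))
        (h.le (h.digitSum_mem (Fin.tail b')))) ?_
      convert h.powIdeal_anti (Nat.le_add_left 1 k) hb using 1
      rw [map_sub]
      ring
    rw [h0, add_sub_add_left_eq_sub, ← mul_sub, mul_mem_powIdeal_succ h.x_ne] at hb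
    rw [← Fin.cons_self_tail b, ← Fin.cons_self_tail b', h0, ih (by omega) hb]

/-- The lattices `R (1 + b t) + x ^ k A`. -/
def latticeOne (τ : Σ k : Fin (m + 1), (Fin k → ResidueField O)) : Submodule R E :=
  lattice h.le x (1 + digitSum x τ.2 * t) τ.1

/-- The lattices `R (x b + t) + x ^ (k + 1) A`. -/
def latticeTwo (τ : Σ k : Fin m, (Fin k → ResidueField O)) : Submodule R E :=
  -- Level 0 is omitted: it is A, already a `latticeOne`. Modulo x^(k+1) A the term x b has only k
  -- free digits.
  lattice h.le x (x * digitSum x τ.2 + t) (τ.1 + 1)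

theorem isBasisPair_latticeOne (τ : Σ k : Fin (m + 1), (Fin k → ResidueField O)) :
    IsBasisPair R A x m (1 + digitSum x τ.2 * t) t :=
  h.isBasisPair_one_add (h.digitSum_mem _)

theorem isBasisPair_latticeTwo (τ : Σ k : Fin m, (Fin k → ResidueField O)) :
    IsBasisPair R A x m (x * digitSum x τ.2 + t) 1 :=
  h.isBasisPair_add (mul_mem h.x_mem (h.digitSum_mem _))

theorem latticeOne_injective : Function.Injective h.latticeOne := by
  rintro ⟨⟨k, hk⟩, b⟩ ⟨⟨j, hj⟩, b'⟩ he
  have hu := h.isBasisPair_latticeOne ⟨⟨k, hk⟩, b⟩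
  have hv := h.isBasisPair_latticeOne ⟨⟨j, hj⟩, b'⟩
  obtain rfl : k = j := le_antisymm (h.le_of_lattice_eq hu (Nat.lt_succ_iff.1 hk) he)
    (h.le_of_lattice_eq hv (Nat.lt_succ_iff.1 hj) he.symm)
  have h1 := self_mem_lattice h.le x (1 + digitSum x b * t) k
  have h2 : lattice h.le x (1 + digitSum x b * t) k = lattice h.le x (1 + digitSum x b' * t) k := he
  rw [h2] at h1
  obtain ⟨r, hr, h3⟩ := mem_lattice.1 h1
  -- Comparing coordinates, r ≡ 1 and b ≡ r b' ≡ b' modulo x^k A.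
  have h4 : 1 + digitSum x b * t - r * (1 + digitSum x b' * t)
    = (1 - r) + (digitSum x b - r * digitSum x b') * t := by ring
  rw [h4] at h3
  have hb := h.digitSum_mem b
  have hb' := h.digitSum_mem b'
  have h5 := h.mem_powIdeal_of_add (Nat.lt_succ_iff.1 hk) (sub_mem (one_mem _) hr)
    (sub_mem hb (mul_mem hr hb')) h3
  have h6 : b = b' := by
    refine h.digitSum_injective (Nat.lt_succ_iff.1 hk) ?_
    convert sub_mem h5.2 (mul_mem_powIdeal (h.le hb') h5.1) using 1
    ring
  rw [h6]

theorem latticeTwo_injective : Function.Injective h.latticeTwo := by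
  rintro ⟨⟨k, hk⟩, b⟩ ⟨⟨j, hj⟩, b'⟩ he
  have hu := h.isBasisPair_latticeTwo ⟨⟨k, hk⟩, b⟩
  have hv := h.isBasisPair_latticeTwo ⟨⟨j, hj⟩, b'⟩
  obtain rfl : k = j := by
    have h1 := h.le_of_lattice_eq hu (Nat.succ_le_of_lt hk) he
    have h2 := h.le_of_lattice_eq hv (Nat.succ_le_of_lt hj) he.symm
    simp only at h1 h2
    omega
  have h1 := self_mem_lattice h.le x (x * digitSum x b + t) (k + 1)
  have h2 : lattice h.le x (x * digitSum x b + t) (k + 1) =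
    lattice h.le x (x * digitSum x b' + t) (k + 1) := he
  rw [h2] at h1
  obtain ⟨r, hr, h3⟩ := mem_lattice.1 h1
  have h4 : x * digitSum x b + t - r * (x * digitSum x b' + t)
    = (x * digitSum x b - r * (x * digitSum x b')) + (1 - r) * t := by ring
  rw [h4] at h3
  have hb := mul_mem h.x_mem (h.digitSum_mem b)
  have hb' := mul_mem h.x_mem (h.digitSum_mem b')
  have h5 := h.mem_powIdeal_of_add (Nat.succ_le_of_lt hk)
    (sub_mem hb (mul_mem hr hb')) (sub_mem (one_mem _) hr) h3
  have h6 : b = b' := by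
    refine h.digitSum_injective hk.le ((mul_mem_powIdeal_succ h.x_ne).1 ?_)
    convert sub_mem h5.1 (mul_mem_powIdeal (h.le hb') h5.2) using 1
    ring
  rw [h6]

theorem latticeOne_ne_latticeTwo (τ : Σ k : Fin (m + 1), (Fin k → ResidueField O))
    (υ : Σ k : Fin m, (Fin k → ResidueField O)) : h.latticeOne τ ≠ h.latticeTwo υ := by
  intro he
  have h1 : x * digitSum x υ.2 + t ∈ h.latticeTwo υ := self_mem_lattice _ _ _ _
  rw [← he] at h1
  -- The common level is at least 1, so coordinates may be compared modulo x: r ≡ 0 from the first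
  -- and 1 ≡ r b' from the second.
  have hk : (υ.1 : ℕ) + 1 ≤ τ.1 :=
    h.le_of_lattice_eq (h.isBasisPair_latticeTwo υ) (Nat.succ_le_of_lt υ.1.2) he.symm
  obtain ⟨r, hr, h3⟩ := mem_lattice.1 h1
  have h4 : x * digitSum x υ.2 + t - r * (1 + digitSum x τ.2 * t)
    = (x * digitSum x υ.2 - r) + (1 - r * digitSum x τ.2) * t := by ring
  rw [h4] at h3
  have hb := mul_mem h.x_mem (h.digitSum_mem υ.2)
  have h5 := h.mem_powIdeal_of_add (Nat.lt_succ_iff.1 τ.1.2) (sub_mem hb hr)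
    (sub_mem (one_mem _) (mul_mem hr (h.digitSum_mem _))) h3
  have h6 : r ∈ powIdeal A x 1 := by
    have h7 := sub_mem (mem_powIdeal.2 ⟨_, h.le (h.digitSum_mem υ.2), by rw [pow_one]⟩)
      (h.powIdeal_anti (by omega : 1 ≤ (τ.1 : ℕ)) h5.1)
    rwa [sub_sub_cancel] at h7
  refine h.one_notMem one_pos ?_
  convert add_mem (h.powIdeal_anti (by omega : 1 ≤ (τ.1 : ℕ)) h5.2)
    (mul_mem_powIdeal (h.le (h.digitSum_mem τ.2)) h6) using 1
  ring

theorem one_add_mul_ne_zero (hm : 1 ≤ m) {b : E} (hb : b ∈ R) : 1 + b * t ≠ 0 := by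
  intro h0
  exact h.one_notMem one_pos (h.mem_powIdeal_of_add hm (one_mem _) hb (h0 ▸ zero_mem _)).1

theorem add_ne_zero (hm : 1 ≤ m) {b : E} (hb : b ∈ R) : b + t ≠ 0 := by
  intro h0
  refine h.one_notMem one_pos (h.mem_powIdeal_of_add hm hb (one_mem _) ?_).2
  rw [one_mul, h0]
  exact zero_mem _

theorem lattice_zero {u v : E} (hu : u ∈ A) (hv : v ∈ A) :
    lattice h.le x u 0 = lattice h.le x v 0 :=
  lattice_congr _ (mem_powIdeal_zero.2 (sub_mem hu hv))

/-- Every lattice in `A` containing a unit of `A` is one of the standard lattices. -/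
theorem exists_latticeOne_or_latticeTwo (hm : 1 ≤ m) (hone : ∀ b ∈ R, (1 + b * t)⁻¹ ∈ A)
    {N : Submodule R E} (hN : ∀ e ∈ N, e ∈ A) {u : E} (hu : u ∈ N) (hu0 : u ≠ 0)
    (huinv : u⁻¹ ∈ A) :
    (∃ τ, N = h.latticeOne τ) ∨
      (∃ τ, N = h.latticeTwo τ) ∧ ∃ a ∈ A, ∃ b ∈ A, x * a + t * b = 1 := by
  have hunit : u ∉ powIdeal A x 1 := fun hu1 =>
    h.one_notMem one_pos (by simpa [inv_mul_cancel₀ hu0] using mul_mem_powIdeal huinv hu1)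
  obtain ⟨r, hr, s, hs, rfl⟩ := h.exists_eq_add_mul u (hN u hu)
  obtain ⟨α, r', hr', rfl⟩ := h.exists_eq_add _ hr
  obtain ⟨β, s', hs', rfl⟩ := h.exists_eq_add _ hs
  -- If α is a unit, so is r, and u rescales to 1 + b t. Otherwise β must be a unit because u ∉ xA,
  -- and u rescales to b + t with b ∈ xA.
  by_cases hα : α ∈ maximalIdeal O
  · have hβ : β ∉ maximalIdeal O := by
      intro hβ
      have h1 := h.powIdeal_anti hm (h.maximalIdeal_le α hα)
      have h2 := h.powIdeal_anti hm (h.maximalIdeal_le β hβ)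
      have h3 : x * (r' + s' * t) ∈ powIdeal A x 1 :=
        mem_powIdeal.2 ⟨_, add_mem (h.le hr') (mul_mem (h.le hs') h.t_mem), by rw [pow_one]⟩
      refine hunit ?_
      convert add_mem (add_mem h1 (mul_mem_powIdeal h.t_mem h2)) h3 using 1
      ring
    set s := algebraMap O E β + x * s' with hsdef
    have hs0 : s ≠ 0 := h.ne_zero_of_notMem (h.le hs') hβ
    have hsinv : s⁻¹ ∈ R := h.inv_mem _ _ hs' hβ
    set r := algebraMap O E α + x * r' with hrdef
    have hb : s⁻¹ * r ∈ R := mul_mem hsinv hr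
    have huN : s⁻¹ * r + t ∈ N := by
      convert mul_mem_submodule hsinv hu using 1
      field_simp
    have hpair := h.isBasisPair_add hb
    have hvinv : (s⁻¹ * r + t)⁻¹ ∈ A := by
      have h1 : (s⁻¹ * r + t)⁻¹ = s * (r + s * t)⁻¹ := by
        rw [← inv_inv s, ← mul_inv, inv_inv]
        congr 1
        field_simp
      rw [h1]
      exact mul_mem (h.le hs) huinv
    obtain ⟨k, hk, rfl⟩ := h.exists_eq_lattice hpair hvinv (h.add_ne_zero hm hb) hN huN
    obtain _ | k := k
    · left
      refine ⟨⟨0, Fin.elim0⟩, h.lattice_zero hpair.mem (h.isBasisPair_latticeOne ⟨0, Fin.elim0⟩).mem⟩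
    · right
      have hr1 : r ∈ powIdeal A x 1 :=
        add_mem (h.powIdeal_anti hm (h.maximalIdeal_le α hα))
          (mem_powIdeal.2 ⟨r', h.le hr', by rw [pow_one]⟩)
      constructor
      · obtain ⟨γ, p, hp, hγ⟩ := h.exists_eq_add _ hb
        have hγ' : γ ∈ maximalIdeal O := by
          refine h.mem_maximalIdeal' (h.le hp) ?_
          rw [← hγ]
          exact mul_mem_powIdeal (h.le hsinv) hr1
        obtain ⟨b, hb'⟩ := h.exists_sub_digitSum_mem (Nat.le_of_succ_le hk) hp
        refine ⟨⟨⟨k, hk⟩, b⟩, lattice_congr _ ?_⟩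
        have h2 := add_mem (h.powIdeal_anti hk (h.maximalIdeal_le γ hγ'))
          ((mul_mem_powIdeal_succ h.x_ne).2 hb')
        convert h2 using 1
        rw [hγ]
        ring
      -- Here r ∈ xA, so the unit r + s t lies in xA + tA. This is what excludes the second family
      -- when t is not a unit.
      · obtain ⟨a, ha, hra⟩ := mem_powIdeal.1 hr1
        refine ⟨_, mul_mem ha huinv, _, mul_mem (h.le hs) huinv, ?_⟩
        rw [pow_one] at hra
        rw [hra] at hu0 ⊢
        field_simp
  · left
    set r := algebraMap O E α + x * r' with hrdef
    set s := algebraMap O E β + x * s' with hsdef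
    have hr0 : r ≠ 0 := h.ne_zero_of_notMem (h.le hr') hα
    have hrinv : r⁻¹ ∈ R := h.inv_mem _ _ hr' hα
    have hb : r⁻¹ * s ∈ R := mul_mem hrinv hs
    have huN : 1 + r⁻¹ * s * t ∈ N := by
      convert mul_mem_submodule hrinv hu using 1
      field_simp
    obtain ⟨k, hk, rfl⟩ := h.exists_eq_lattice (h.isBasisPair_one_add hb) (hone _ hb)
      (h.one_add_mul_ne_zero hm hb) hN huN
    obtain ⟨b, hb'⟩ := h.exists_sub_digitSum_mem hk hb
    refine ⟨⟨⟨k, Nat.lt_succ_of_le hk⟩, b⟩, lattice_congr _ ?_⟩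
    convert mul_mem_powIdeal h.t_mem hb' using 1
    simp only
    ring

end IsDoubleOrder
end DoubleOrder

/-! ### The length of A/R, and normalization by powers of a uniformizer -/

section DoubleOrder

open IsLocalRing

namespace IsDoubleOrder

section Length

variable {O : Type*} [CommRing O] [IsLocalRing O] {E : Type*} [Field E] [Algebra O E]
  {R A : Subalgebra O E} {x t : E} {m : ℕ} (h : IsDoubleOrder R A x t m)

include h

theorem sum_mem_powIdeal_iff {k : ℕ} (hk : k ≤ m) (c : Fin k → O) :
    ∑ i, algebraMap O E (c i) * x ^ (i : ℕ) ∈ powIdeal A x k ↔ ∀ i, c i ∈ maximalIdeal O := by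
  constructor
  · intro hc
    induction k with
    | zero => exact fun i => i.elim0
    | succ k ih =>
      have hs : ∑ i, algebraMap O E (c i) * x ^ (i : ℕ) = algebraMap O E (c 0) +
          x * ∑ i : Fin k, algebraMap O E (c i.succ) * x ^ (i : ℕ) := by
        rw [Fin.sum_univ_succ, Finset.mul_sum]
        simp only [Fin.val_zero, pow_zero, mul_one, Fin.val_succ, pow_succ']
        congr 1
        exact Finset.sum_congr rfl fun i _ => by ring
      rw [hs] at hc
      have h0 : c 0 ∈ maximalIdeal O :=
        h.mem_maximalIdeal' (sum_mem fun _ _ => mul_mem (A.algebraMap_mem _)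
          (pow_mem (h.le h.x_mem) _)) (h.powIdeal_anti (Nat.le_add_left 1 k) hc)
      have h1 := sub_mem hc (h.powIdeal_anti hk (h.maximalIdeal_le _ h0))
      rw [add_sub_cancel_left, mul_mem_powIdeal_succ h.x_ne] at h1
      exact fun i => Fin.cases h0 (ih (by omega) _ h1) i
  · intro hc
    refine sum_mem fun i _ => ?_
    rw [mul_comm]
    exact mul_mem_powIdeal (pow_mem (h.le h.x_mem) _)
      (h.powIdeal_anti hk (h.maximalIdeal_le _ (hc i)))

theorem mul_mem_iff {s : E} (hs : s ∈ R) : s * t ∈ R ↔ s ∈ powIdeal A x m := by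
  constructor
  · intro hst
    refine (h.mem_powIdeal_of_add le_rfl (neg_mem hst) hs ?_).2
    rw [neg_add_cancel]
    exact zero_mem _
  · intro hst
    rw [mul_comm]
    exact h.powIdeal_subset (mul_mem_powIdeal h.t_mem hst)

/-- A/R is spanned by t, x t, …, x^(m-1) t, and a combination of these lies in R exactly when all
its coefficients lie in the maximal ideal. Hence A/R ≅ κ^m. -/
theorem length_quotient :
    Module.length O (Subalgebra.toSubmodule A ⧸
      (Subalgebra.toSubmodule R).submoduleOf (Subalgebra.toSubmodule A)) = m := by
  set P := (Subalgebra.toSubmodule R).submoduleOf (Subalgebra.toSubmodule A)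
  have hx : ∀ i : ℕ, x ^ i * t ∈ Subalgebra.toSubmodule A := fun i =>
    (Subalgebra.mem_toSubmodule A).2 (mul_mem (pow_mem (h.le h.x_mem) i) h.t_mem)
  let f : (Fin m → O) →ₗ[O] (Subalgebra.toSubmodule A ⧸ P) :=
    P.mkQ ∘ₗ Fintype.linearCombination O (fun i : Fin m => ⟨x ^ (i : ℕ) * t, hx i⟩)
  let g : (Fin m → O) →ₗ[O] (Fin m → ResidueField O) :=
    (Algebra.linearMap O (ResidueField O)).compLeft (Fin m)
  have hval : ∀ c : Fin m → O, ((Fintype.linearCombination O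
      (fun i : Fin m => (⟨x ^ (i : ℕ) * t, hx i⟩ : Subalgebra.toSubmodule A)) c :
        Subalgebra.toSubmodule A) : E) = (∑ i, algebraMap O E (c i) * x ^ (i : ℕ)) * t := by
    intro c
    rw [Fintype.linearCombination_apply, Submodule.coe_sum, Finset.sum_mul]
    refine Finset.sum_congr rfl fun i _ => ?_
    rw [Submodule.coe_smul, Algebra.smul_def, mul_assoc]
  have hf : Function.Surjective f := by
    intro y
    obtain ⟨⟨a, ha⟩, rfl⟩ := P.mkQ_surjective y
    obtain ⟨r, hr, s, hs, rfl⟩ := h.exists_eq_add_mul a ha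
    obtain ⟨b, hb⟩ := h.exists_sub_digitSum_mem le_rfl hs
    refine ⟨fun i => residueLift (b i), ?_⟩
    rw [LinearMap.comp_apply, ← sub_eq_zero, ← map_sub, Submodule.mkQ_apply,
      Submodule.Quotient.mk_eq_zero]
    change ((Fintype.linearCombination O
      (fun i : Fin m => (⟨x ^ (i : ℕ) * t, hx i⟩ : Subalgebra.toSubmodule A)) _ :
        Subalgebra.toSubmodule A) : E) - (r + s * t) ∈ R
    rw [hval, ← neg_mem_iff]
    have h1 := (h.mul_mem_iff (sub_mem hs (h.digitSum_mem b))).2 hb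
    convert add_mem hr h1 using 1
    rw [digitSum]
    ring
  have hg : Function.Surjective g := fun y =>
    ⟨fun i => residueLift (y i), funext fun i => residue_residueLift (y i)⟩
  have hker : LinearMap.ker f = LinearMap.ker g := by
    ext c
    rw [LinearMap.mem_ker, LinearMap.mem_ker, LinearMap.comp_apply, Submodule.mkQ_apply,
      Submodule.Quotient.mk_eq_zero]
    have h1 : g c = 0 ↔ ∀ i, c i ∈ maximalIdeal O := by
      rw [funext_iff]
      exact forall_congr' fun i => residue_eq_zero_iff (c i)
    rw [h1, ← h.sum_mem_powIdeal_iff le_rfl, ← h.mul_mem_iff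
      (sum_mem fun _ _ => mul_mem (R.algebraMap_mem _) (pow_mem h.x_mem _)), ← hval]
    rfl
  have e : (Subalgebra.toSubmodule A ⧸ P) ≃ₗ[O] (Fin m → ResidueField O) :=
    (f.quotKerEquivOfSurjective hf).symm ≪≫ₗ Submodule.quotEquivOfEq _ _ hker ≪≫ₗ
      g.quotKerEquivOfSurjective hg
  rw [e.length_eq, Module.length_eq_of_surjective (S := O) (R := ResidueField O) residue_surjective,
    Module.length_eq_finrank, Module.finrank_fin_fun]

end Length

end IsDoubleOrder

/-- `p` is a uniformizer of the discrete valuation ring `A` with field of fractions `E`. -/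
structure IsUniformizerOf {O : Type*} [CommRing O] {E : Type*} [Field E] [Algebra O E]
    (A : Subalgebra O E) (p : Eˣ) : Prop where
  mem : (p : E) ∈ A
  inv_notMem : (p : E)⁻¹ ∉ A
  exists_eq_zpow_mul : ∀ e : E, e ≠ 0 → ∃ j : ℤ, ∃ u ∈ A, u⁻¹ ∈ A ∧ e = (p : E) ^ j * u

namespace IsUniformizerOf

variable {O : Type*} [CommRing O] {E : Type*} [Field E] [Algebra O E] {A : Subalgebra O E}
  {p : Eˣ} (hp : IsUniformizerOf A p)

include hp

theorem zpow_mem_iff {j : ℤ} : (p : E) ^ j ∈ A ↔ 0 ≤ j := by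
  constructor
  · intro hj
    by_contra! hneg
    refine hp.inv_notMem ?_
    obtain ⟨n, hn⟩ := Int.eq_ofNat_of_zero_le (by omega : 0 ≤ -j - 1)
    have h1 := mul_mem hj (pow_mem hp.mem n)
    rw [← zpow_natCast, ← zpow_add₀ p.ne_zero, ← hn] at h1
    rwa [← zpow_neg_one, show (-1 : ℤ) = j + (-j - 1) by ring]
  · intro hj
    obtain ⟨n, rfl⟩ := Int.eq_ofNat_of_zero_le hj
    rw [zpow_natCast]
    exact pow_mem hp.mem n

theorem zpow_mul_mem_iff {j : ℤ} {u : E} (hu : u ∈ A) (hu' : u⁻¹ ∈ A) (hu0 : u ≠ 0) :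
    (p : E) ^ j * u ∈ A ↔ 0 ≤ j := by
  rw [← hp.zpow_mem_iff]
  exact ⟨fun h1 => by simpa [mul_assoc, hu0] using mul_mem h1 hu', fun h1 => mul_mem h1 hu⟩

variable {R : Subalgebra O E}

/-- A submodule of A meeting the units of A has least valuation 0, and multiplication by p^j shifts
the least valuation by j. -/
theorem eq_zero_of_zpow_smul_eq {M N : Submodule R E} (hM : ∀ e ∈ M, e ∈ A) (hN : ∀ e ∈ N, e ∈ A)
    {u v : E} (hu : u ∈ M) (hv : v ∈ N) (hu0 : u ≠ 0) (hv0 : v ≠ 0) (hu' : u⁻¹ ∈ A)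
    (hv' : v⁻¹ ∈ A) {j : ℤ} (hMN : p ^ j • M = N) : j = 0 := by
  have h1 : (p : E) ^ j * u ∈ N := by
    rw [← hMN]
    have := Submodule.smul_mem_pointwise_smul u (p ^ j) M hu
    rwa [Units.smul_def, smul_eq_mul, Units.val_zpow_eq_zpow_val] at this
  have h2 : (p : E) ^ (-j) * v ∈ M := by
    have h3 : M = (p ^ (-j)) • N := by rw [← hMN, smul_smul, zpow_neg, inv_mul_cancel, one_smul]
    rw [h3]
    have := Submodule.smul_mem_pointwise_smul v (p ^ (-j)) N hv
    rwa [Units.smul_def, smul_eq_mul, Units.val_zpow_eq_zpow_val] at this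
  have h3 := (hp.zpow_mul_mem_iff (hM u hu) hu' hu0).1 (hN _ h1)
  have h4 := (hp.zpow_mul_mem_iff (hN v hv) hv' hv0).1 (hM _ h2)
  omega

/-- A nonzero finitely generated submodule can be moved into `A` so that it contains a unit. -/
theorem exists_zpow_smul (hle : R ≤ A) {M : Submodule R E} (hfg : M.FG) (hM : M ≠ ⊥) :
    ∃ j : ℤ, (∀ e ∈ p ^ j • M, e ∈ A) ∧ ∃ u ∈ p ^ j • M, u ≠ 0 ∧ u⁻¹ ∈ A := by
  obtain ⟨s, rfl⟩ := hfg
  have hbd : ∃ b : ℕ, ∀ e ∈ s, (p : E) ^ (b : ℤ) * e ∈ A := by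
    classical
    induction s using Finset.induction_on with
    | empty => exact ⟨0, by simp⟩
    | insert a s ha ih =>
      have hle' : ∃ b : ℕ, ∀ e ∈ s, (p : E) ^ (b : ℤ) * e ∈ A := by
        -- The induction hypothesis carries the assumption that the span is nonzero, so the zero
        -- span is treated apart.
        by_cases h0 : Submodule.span R (s : Set E) = ⊥
        · refine ⟨0, fun e he => ?_⟩
          have : e ∈ Submodule.span R (s : Set E) := Submodule.subset_span he
          rw [h0, Submodule.mem_bot] at this
          simp [this]
        · exact ih h0
      obtain ⟨b, hb⟩ := hle'
      have ha' : ∃ b : ℕ, (p : E) ^ (b : ℤ) * a ∈ A := by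
        by_cases h0 : a = 0
        · exact ⟨0, by simp [h0]⟩
        · obtain ⟨j, u, hu, hu', rfl⟩ := hp.exists_eq_zpow_mul a h0
          refine ⟨j.natAbs, ?_⟩
          rw [← mul_assoc, ← zpow_add₀ p.ne_zero]
          exact mul_mem (hp.zpow_mem_iff.2 (by omega)) hu
      obtain ⟨b', hb'⟩ := ha'
      refine ⟨b + b', fun e he => ?_⟩
      push_cast
      rw [zpow_add₀ p.ne_zero]
      rcases Finset.mem_insert.1 he with rfl | he
      · rw [mul_assoc]
        exact mul_mem (hp.zpow_mem_iff.2 (by positivity)) hb'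
      · rw [mul_comm ((p : E) ^ (b : ℤ)), mul_assoc]
        exact mul_mem (hp.zpow_mem_iff.2 (by positivity)) (hb e he)
  obtain ⟨b, hb⟩ := hbd
  set M := Submodule.span R (s : Set E) with hMdef
  have hbM : ∀ e ∈ M, (p : E) ^ (b : ℤ) * e ∈ A := by
    intro e he
    induction he using Submodule.span_induction with
    | mem y hy => exact hb y hy
    | zero => simp
    | add y z _ _ hy hz => rw [mul_add]; exact add_mem hy hz
    | smul r y _ hy =>
      rw [Subalgebra.smul_def, smul_eq_mul, mul_left_comm]
      exact mul_mem (hle r.2) hy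
  obtain ⟨e₀, he₀, hne⟩ := Submodule.exists_mem_ne_zero_of_ne_bot hM
  -- `j₀` is the least valuation of a nonzero element of M; the common denominator p^b bounds it
  -- below.
  obtain ⟨j₀, ⟨u, hu, hu', hu0, hmem⟩, hmin⟩ := Int.exists_least_of_bdd
    (P := fun j : ℤ => ∃ u ∈ A, u⁻¹ ∈ A ∧ u ≠ 0 ∧ (p : E) ^ j * u ∈ M)
    ⟨-b, by
      rintro j ⟨u, hu, hu', hu0, hmem⟩
      have h1 := hbM _ hmem
      rw [← mul_assoc, ← zpow_add₀ p.ne_zero, hp.zpow_mul_mem_iff hu hu' hu0] at h1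
      omega⟩
    (by
      obtain ⟨j, u, hu, hu', he⟩ := hp.exists_eq_zpow_mul e₀ hne
      exact ⟨j, u, hu, hu', by rintro rfl; simp [he] at hne, he ▸ he₀⟩)
  refine ⟨-j₀, ?_, u, ?_, hu0, hu'⟩
  · intro e he
    obtain ⟨y, hy, rfl⟩ := (Submodule.mem_smul_pointwise_iff_exists _ _ _).1 he
    rw [Units.smul_def, smul_eq_mul, Units.val_zpow_eq_zpow_val]
    by_cases hy0 : y = 0
    · simp [hy0]
    · obtain ⟨j, v, hv, hv', rfl⟩ := hp.exists_eq_zpow_mul y hy0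
      have hj := hmin j ⟨v, hv, hv', by rintro rfl; simp at hy0, hy⟩
      rw [← mul_assoc, ← zpow_add₀ p.ne_zero]
      exact mul_mem (hp.zpow_mem_iff.2 (by omega)) hv
  · refine (Submodule.mem_smul_pointwise_iff_exists _ _ _).2 ⟨_, hmem, ?_⟩
    rw [Units.smul_def, smul_eq_mul, Units.val_zpow_eq_zpow_val, ← mul_assoc,
      ← zpow_add₀ p.ne_zero, neg_add_cancel, zpow_zero, one_mul]

end IsUniformizerOf
end DoubleOrder

/-! ### Counting orbits -/

section Counting

open IsLocalRing

variable {F : Type*} [Field F] [ValuativeRel F] [TopologicalSpace F]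
  [IsNonarchimedeanLocalField F] {E : Type*} [Field E] [Algebra F E]
  {R A : Subalgebra 𝒪[F] E} {x t : E} {m : ℕ}

namespace IsDoubleOrder

theorem isFractionalIdeal_lattice (h : IsDoubleOrder R A x t m)
    (hspan : Submodule.span F (R : Set E) = ⊤) {u u' : E} (hu : IsBasisPair R A x m u u') (k : ℕ) :
    IsFractionalIdeal R (lattice h.le x u k) := by
  classical
  constructor
  · refine ⟨{u, x ^ k * u'}, le_antisymm ?_ ?_⟩
    · rw [Submodule.span_le]
      intro e he
      simp only [Finset.coe_insert, Finset.coe_singleton, Set.mem_insert_iff,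
        Set.mem_singleton_iff] at he
      rcases he with rfl | rfl
      · exact self_mem_lattice h.le x _ k
      · exact powIdeal_mem_lattice _ _ (mem_powIdeal.2 ⟨u', hu.mem', rfl⟩)
    · rintro e ⟨r, hr, he⟩
      obtain ⟨a, ha, he⟩ := mem_powIdeal.1 he
      obtain ⟨p, hp, q, hq, rfl⟩ := hu.exists_eq a ha
      have h1 : u ∈ Submodule.span R (({u, x ^ k * u'} : Finset E) : Set E) :=
        Submodule.subset_span (by simp)
      have h2 : x ^ k * u' ∈ Submodule.span R (({u, x ^ k * u'} : Finset E) : Set E) :=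
        Submodule.subset_span (by simp)
      rw [sub_eq_iff_eq_add] at he
      rw [he]
      have h3 := add_mem (mul_mem_submodule (add_mem (mul_mem (pow_mem h.x_mem k) hp) hr) h1)
        (mul_mem_submodule hq h2)
      convert h3 using 1
      ring
  · refine eq_top_iff.2 fun e _ => ?_
    -- The lattice contains x^k R, and multiplication by x^k is bijective on E.
    have key : ∀ y ∈ Submodule.span F (R : Set E),
        x ^ k * y ∈ Submodule.span F (lattice h.le x u k : Set E) := by
      intro y hy
      induction hy using Submodule.span_induction with
      | mem y hy =>
        exact Submodule.subset_span
          (powIdeal_mem_lattice _ _ (mem_powIdeal.2 ⟨y, h.le hy, rfl⟩))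
      | zero => simp
      | add y z _ _ hy hz => rw [mul_add]; exact add_mem hy hz
      | smul c y _ hy => rw [mul_smul_comm]; exact Submodule.smul_mem _ _ hy
    have h1 := key ((x ^ k)⁻¹ * e) (hspan ▸ Submodule.mem_top)
    rwa [mul_inv_cancel_left₀ (pow_ne_zero _ h.x_ne)] at h1

theorem lattice_le (h : IsDoubleOrder R A x t m) {u : E} (hu : u ∈ A) (k : ℕ) :
    ∀ e ∈ lattice h.le x u k, e ∈ A := by
  rintro e ⟨r, hr, he⟩
  simpa using add_mem (h.mem_of_mem_powIdeal he) (mul_mem (h.le hr) hu)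

end IsDoubleOrder

omit [TopologicalSpace F] [IsNonarchimedeanLocalField F] in
/-- If `T` parametrizes the fractional ideals contained in `A` and containing a unit of `A`, then
it parametrizes the orbits of `Λ`. -/
theorem orbitalIntegral_eq_card {πE : Eˣ} (hp : IsUniformizerOf A πE) (hle : R ≤ A) {T : Type*}
    (L : T → Submodule R E) (hL : Function.Injective L) (hfrac : ∀ τ, IsFractionalIdeal R (L τ))
    (hLA : ∀ τ, ∀ e ∈ L τ, e ∈ A) (hLu : ∀ τ, ∃ u ∈ L τ, u ≠ 0 ∧ u⁻¹ ∈ A)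
    (hsurj : ∀ N : Submodule R E, (∀ e ∈ N, e ∈ A) → (∃ u ∈ N, u ≠ 0 ∧ u⁻¹ ∈ A) →
      ∃ τ, N = L τ) :
    orbitalIntegral R πE = Nat.card T := by
  symm
  refine Nat.card_eq_of_bijective (fun τ => (Quotient.mk _ (⟨L τ, hfrac τ⟩ : fractionalIdeals R) :
    MulAction.orbitRel.Quotient (Subgroup.zpowers πE) (fractionalIdeals R))) ⟨?_, ?_⟩
  · intro τ υ hτυ
    obtain ⟨⟨g, j, rfl⟩, hg⟩ := MulAction.orbitRel_apply.1 (Quotient.exact hτυ)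
    have hg' : πE ^ j • L υ = L τ := congrArg Subtype.val hg
    obtain ⟨u, hu, hu0, hu'⟩ := hLu υ
    obtain ⟨v, hv, hv0, hv'⟩ := hLu τ
    obtain rfl := hp.eq_zero_of_zpow_smul_eq (hLA υ) (hLA τ) hu hv hu0 hv0 hu' hv' hg'
    rw [zpow_zero, one_smul] at hg'
    exact hL hg'.symm
  · intro q
    obtain ⟨⟨M, hM⟩, rfl⟩ := Quotient.exists_rep q
    have hM0 : M ≠ ⊥ := by
      rintro rfl
      have h1 := hM.2
      rw [Submodule.bot_coe, Submodule.span_zero_singleton] at h1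
      exact bot_ne_top h1
    obtain ⟨j, hjA, hju⟩ := hp.exists_zpow_smul hle hM.1 hM0
    obtain ⟨τ, hτ⟩ := hsurj _ hjA hju
    refine ⟨τ, Quotient.sound (MulAction.orbitRel_apply.2 ⟨⟨πE ^ j, j, rfl⟩, Subtype.ext ?_⟩)⟩
    exact hτ

theorem card_sigma_residueField (n : ℕ) :
    Nat.card (Σ k : Fin n, (Fin k → 𝓀[F])) = ∑ i ∈ Finset.range n, residueCard F ^ i := by
  rw [Nat.card_sigma, Finset.sum_range]
  exact Finset.sum_congr rfl fun i _ => by rw [Nat.card_fun, Nat.card_fin, residueCard]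

namespace IsDoubleOrder

variable (h : IsDoubleOrder R A x t m) (hm : 1 ≤ m) {πE : Eˣ} (hp : IsUniformizerOf A πE)
  (hspan : Submodule.span F (R : Set E) = ⊤) (hone : ∀ b ∈ R, (1 + b * t)⁻¹ ∈ A)

include h hm hp hspan hone

/-- When x and t generate a proper ideal, no normalized lattice needs the second family. -/
theorem orbitalIntegral_of_nonunit (ht : ∀ a ∈ A, ∀ b ∈ A, x * a + t * b ≠ 1) :
    orbitalIntegral R πE = ∑ i ∈ Finset.range (m + 1), residueCard F ^ i := by
  rw [orbitalIntegral_eq_card hp h.le h.latticeOne h.latticeOne_injective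
    (fun τ => h.isFractionalIdeal_lattice hspan (h.isBasisPair_latticeOne τ) _)
    (fun τ => h.lattice_le (h.isBasisPair_latticeOne τ).mem _)
    (fun τ => ⟨_, self_mem_lattice _ _ _ _, h.one_add_mul_ne_zero hm (h.digitSum_mem _),
      hone _ (h.digitSum_mem _)⟩), card_sigma_residueField]
  rintro N hN ⟨u, hu, hu0, hu'⟩
  obtain h1 | ⟨-, a, ha, b, hb, hab⟩ :=
    h.exists_latticeOne_or_latticeTwo hm hone hN hu hu0 hu'
  · exact h1
  · exact absurd hab (ht a ha b hb)

theorem orbitalIntegral_of_unit (ht : ∀ a ∈ R, (x * a + t)⁻¹ ∈ A) :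
    orbitalIntegral R πE = ∑ i ∈ Finset.range (m + 1), residueCard F ^ i +
      ∑ i ∈ Finset.range m, residueCard F ^ i := by
  rw [orbitalIntegral_eq_card hp h.le (Sum.elim h.latticeOne h.latticeTwo)
    (h.latticeOne_injective.sumElim h.latticeTwo_injective h.latticeOne_ne_latticeTwo),
    Nat.card_sum, card_sigma_residueField, card_sigma_residueField]
  · rintro (τ | τ)
    · exact h.isFractionalIdeal_lattice hspan (h.isBasisPair_latticeOne τ) _
    · exact h.isFractionalIdeal_lattice hspan (h.isBasisPair_latticeTwo τ) _
  · rintro (τ | τ)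
    · exact h.lattice_le (h.isBasisPair_latticeOne τ).mem _
    · exact h.lattice_le (h.isBasisPair_latticeTwo τ).mem _
  · rintro (τ | τ)
    · exact ⟨_, self_mem_lattice h.le x _ _, h.one_add_mul_ne_zero hm (h.digitSum_mem _),
        hone _ (h.digitSum_mem _)⟩
    · exact ⟨_, self_mem_lattice h.le x _ _, h.add_ne_zero hm
        (mul_mem h.x_mem (h.digitSum_mem _)), ht _ (h.digitSum_mem _)⟩
  · rintro N hN ⟨u, hu, hu0, hu'⟩
    obtain ⟨τ, h1⟩ | ⟨⟨τ, h1⟩, -⟩ :=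
      h.exists_latticeOne_or_latticeTwo hm hone hN hu hu0 hu'
    · exact ⟨.inl τ, h1⟩
    · exact ⟨.inr τ, h1⟩

end IsDoubleOrder
end Counting

/-! ### Recognizing discrete valuation rings among integral subalgebras of E -/

section DiscreteValuation

open IsLocalRing

/-- A noetherian domain whose maximal ideals are all generated by the same nonzero element is a
discrete valuation ring. -/
theorem isDiscreteValuationRing_of_isMaximal_eq_span {B : Type*} [CommRing B] [IsDomain B]
    [IsNoetherianRing B] {p : B} (hp : p ≠ 0) (h : ∀ I : Ideal B, I.IsMaximal → I = Ideal.span {p}) :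
    IsDiscreteValuationRing B ∧ Irreducible p := by
  obtain ⟨I, hI⟩ := Ideal.exists_maximal B
  have hloc : IsLocalRing B :=
    IsLocalRing.of_unique_max_ideal ⟨I, hI, fun J hJ => (h J hJ).trans (h I hI).symm⟩
  have hmax : maximalIdeal B = Ideal.span {p} := h _ (maximalIdeal.isMaximal B)
  have hfield : ¬IsField B := by
    rw [isField_iff_maximalIdeal_eq, hmax, Ideal.span_singleton_eq_bot]
    exact hp
  have : IsDiscreteValuationRing B :=
    ((IsDiscreteValuationRing.TFAE B hfield).out 0 4 rfl rfl).2 ⟨p, hmax⟩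
  exact ⟨this, (IsDiscreteValuationRing.irreducible_iff_uniformizer p).2 hmax⟩

variable {O : Type*} [CommRing O] {E : Type*} [Field E] [Algebra O E] {B : Subalgebra O E}

theorem inv_mem_of_isUnit {b : B} (hb : IsUnit b) : (b : E)⁻¹ ∈ B := by
  obtain ⟨u, rfl⟩ := hb
  have h1 : ((u : B) : E) * ((u⁻¹ : Bˣ) : B) = 1 := by
    rw [← MulMemClass.coe_mul, Units.mul_inv, OneMemClass.coe_one]
  rw [inv_eq_of_mul_eq_one_right h1]
  exact Subtype.mem _

theorem isUniformizerOf_of_irreducible [IsDiscreteValuationRing B] [IsFractionRing B E] {p : B}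
    (hp : Irreducible p) {πE : Eˣ} (hπE : (p : E) = πE) : IsUniformizerOf B πE where
  mem := hπE ▸ p.2
  inv_notMem hinv := by
    refine hp.not_isUnit (.of_mul_eq_one ⟨_, hinv⟩ (Subtype.ext ?_))
    rw [MulMemClass.coe_mul, hπE, mul_inv_cancel₀ πE.ne_zero, OneMemClass.coe_one]
  exists_eq_zpow_mul e he := by
    obtain ⟨j, u, rfl⟩ := IsDiscreteValuationRing.exists_units_eq_smul_zpow_of_irreducible hp he
    refine ⟨j, (u : B), Subtype.mem _, inv_mem_of_isUnit u.isUnit, ?_⟩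
    rw [Units.smul_def, Algebra.smul_def, mul_comm, ← hπE]
    rfl

/-- An integrally closed integral subalgebra is the integral closure. -/
theorem eq_integralClosure [Algebra.IsIntegral O B] [IsFractionRing B E] [IsIntegrallyClosed B] :
    B = integralClosure O E := by
  refine le_antisymm (fun e he => ?_) (fun e he => ?_)
  · exact (Algebra.IsIntegral.isIntegral (R := O) (⟨e, he⟩ : B)).map B.val
  · have h1 : IsIntegral B e := IsIntegral.tower_top (R := O) he
    obtain ⟨b, rfl⟩ := IsIntegrallyClosed.isIntegral_iff.1 h1
    exact b.2

theorem isFractionRing_of_exists_pow_mul_mem {c : O} (hc : algebraMap O E c ≠ 0)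
    (h : ∀ e : E, ∃ k : ℕ, algebraMap O E c ^ k * e ∈ B) : IsFractionRing B E := by
  refine IsFractionRing.of_field B E fun e => ?_
  obtain ⟨k, hk⟩ := h e
  refine ⟨⟨_, hk⟩, ⟨_, pow_mem (B.algebraMap_mem c) k⟩, ?_⟩
  change e = (algebraMap O E c ^ k * e) / algebraMap O E c ^ k
  rw [eq_div_iff (pow_ne_zero _ hc), mul_comm]

/-- An ideal of a subalgebra of `E`, as a subset of `E`. -/
def idealImage (I : Ideal B) : Submodule B E :=
  Submodule.map (Algebra.linearMap B E) I

theorem mem_idealImage {I : Ideal B} {b : B} : (b : E) ∈ idealImage I ↔ b ∈ I := by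
  constructor
  · rintro ⟨c, hc, hcb⟩
    obtain rfl : c = b := Subtype.ext hcb
    exact hc
  · exact fun hb => ⟨b, hb, rfl⟩

theorem mem_of_mem_idealImage {I : Ideal B} {e : E} (he : e ∈ idealImage I) : e ∈ B := by
  obtain ⟨b, -, rfl⟩ := he
  exact b.2

theorem mul_mem_idealImage {I : Ideal B} {b e : E} (hb : b ∈ B) (he : e ∈ idealImage I) :
    b * e ∈ idealImage I :=
  (idealImage I).smul_mem ⟨b, hb⟩ he

theorem mem_idealImage_of_pow {I : Ideal B} (hI : I.IsPrime) {e : E} (he : e ∈ B) {k : ℕ}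
    (hk : e ^ k ∈ idealImage I) : e ∈ idealImage I := by
  have h1 : ((⟨e, he⟩ ^ k : B) : E) ∈ idealImage I := hk
  exact mem_idealImage.2 (hI.mem_of_pow_mem k (mem_idealImage.1 h1))

/-- Along an integral extension a maximal ideal contracts to a maximal ideal, and O has only one. -/
theorem algebraMap_mem_idealImage [IsLocalRing O] [Algebra.IsIntegral O B] {I : Ideal B}
    (hI : I.IsMaximal) {c : O} : algebraMap O E c ∈ idealImage I ↔ c ∈ maximalIdeal O := by
  have h1 := eq_maximalIdeal (Ideal.isMaximal_comap_of_isIntegral_of_isMaximal (R := O) I)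
  rw [← h1, Ideal.mem_comap, ← mem_idealImage]
  rfl

theorem one_notMem_idealImage {I : Ideal B} (hI : I.IsMaximal) : (1 : E) ∉ idealImage I :=
  fun h1 => hI.ne_top ((Ideal.eq_top_iff_one I).2 (mem_idealImage.1 h1))

theorem inv_mem_of_forall_notMem {e : E} (he : e ∈ B)
    (h : ∀ I : Ideal B, I.IsMaximal → e ∉ idealImage I) : e⁻¹ ∈ B := by
  refine inv_mem_of_isUnit (b := ⟨e, he⟩) ?_
  by_contra hu
  obtain ⟨I, hI, heI⟩ := exists_max_ideal_of_mem_nonunits hu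
  exact h I hI (mem_idealImage.2 heI)

end DiscreteValuation

/-! ### Adjoining a quadratic element -/

section QuadraticExtension

variable {O : Type*} [CommRing O] {E : Type*} [Field E] [Algebra O E]

/-- The subalgebra `R + R t`, where `t ^ 2 = a + b t`. -/
def quadraticExtension (R : Subalgebra O E) {t a b : E} (ha : a ∈ R) (hb : b ∈ R)
    (ht : t ^ 2 = a + b * t) : Subalgebra O E where
  carrier := {e | ∃ r ∈ R, ∃ s ∈ R, e = r + s * t}
  add_mem' := by
    rintro _ _ ⟨r, hr, s, hs, rfl⟩ ⟨r', hr', s', hs', rfl⟩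
    exact ⟨r + r', add_mem hr hr', s + s', add_mem hs hs', by ring⟩
  mul_mem' := by
    rintro _ _ ⟨r, hr, s, hs, rfl⟩ ⟨r', hr', s', hs', rfl⟩
    refine ⟨r * r' + s * s' * a, add_mem (mul_mem hr hr') (mul_mem (mul_mem hs hs') ha),
      r * s' + s * r' + s * s' * b, add_mem (add_mem (mul_mem hr hs') (mul_mem hs hr'))
        (mul_mem (mul_mem hs hs') hb), ?_⟩
    linear_combination s * s' * ht
  algebraMap_mem' c := ⟨_, R.algebraMap_mem c, 0, zero_mem _, by simp⟩

variable {R : Subalgebra O E} {t a b : E} (ha : a ∈ R) (hb : b ∈ R) (ht : t ^ 2 = a + b * t)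

theorem mem_quadraticExtension {e : E} :
    e ∈ quadraticExtension R ha hb ht ↔ ∃ r ∈ R, ∃ s ∈ R, e = r + s * t := Iff.rfl

theorem le_quadraticExtension : R ≤ quadraticExtension R ha hb ht :=
  fun r hr => ⟨r, hr, 0, zero_mem _, by simp⟩

theorem self_mem_quadraticExtension : t ∈ quadraticExtension R ha hb ht :=
  ⟨0, zero_mem _, 1, one_mem _, by simp⟩

theorem finite_quadraticExtension [hR : Module.Finite O R] :
    Module.Finite O (quadraticExtension R ha hb ht) := by
  have h1 : (Subalgebra.toSubmodule R).FG := Module.Finite.iff_fg.1 hR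
  have h2 : Subalgebra.toSubmodule (quadraticExtension R ha hb ht) =
      Subalgebra.toSubmodule R ⊔
        Submodule.map (LinearMap.mulRight O t) (Subalgebra.toSubmodule R) := by
    ext e
    rw [Subalgebra.mem_toSubmodule, mem_quadraticExtension, Submodule.mem_sup]
    constructor
    · rintro ⟨r, hr, s, hs, rfl⟩
      exact ⟨r, hr, _, ⟨s, hs, rfl⟩, rfl⟩
    · rintro ⟨r, hr, _, ⟨s, hs, rfl⟩, rfl⟩
      exact ⟨r, hr, s, hs, rfl⟩
  have h3 : (Subalgebra.toSubmodule (quadraticExtension R ha hb ht)).FG := by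
    rw [h2]
    exact h1.sup (h1.map _)
  exact Module.Finite.iff_fg.2 h3

end QuadraticExtension

/-! ### The overorder generated by ϖ / ξ^m -/

section DoublePoint

open IsLocalRing

variable {O : Type*} [CommRing O] [IsLocalRing O] {E : Type*} [Field E] [Algebra O E]

/-- `ξ` is a root of `ϖ ^ 2 w + ϖ X ^ (m + δ) v + X ^ (2 m + δ)`, where `w (0)` is a unit. -/
structure IsDoublePoint (ϖ : O) (ξ : E) (m δ : ℕ) (w v : O[X]) : Prop where
  span_eq : maximalIdeal O = Ideal.span {ϖ}
  ne_zero : algebraMap O E ϖ ≠ 0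
  isIntegral : IsIntegral O ξ
  isUnit : IsUnit (w.coeff 0)
  pos : 1 ≤ m
  rel : algebraMap O E ϖ ^ 2 * aeval ξ w + algebraMap O E ϖ * ξ ^ (m + δ) * aeval ξ v
    + ξ ^ (2 * m + δ) = 0

omit [IsLocalRing O] in
theorem aeval_eq_add (ξ : E) (p : O[X]) :
    aeval ξ p = algebraMap O E (p.coeff 0) + ξ * aeval ξ p.divX := by
  conv_lhs => rw [← divX_mul_X_add p]
  rw [map_add, map_mul, aeval_X, aeval_C]
  ring

omit [IsLocalRing O] in
theorem mem_adjoin_iff {ξ e : E} : e ∈ Algebra.adjoin O {ξ} ↔ ∃ p : O[X], aeval ξ p = e := by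
  rw [Algebra.adjoin_singleton_eq_range_aeval, AlgHom.mem_range]

omit [IsLocalRing O] in
theorem exists_eq_add_of_mem_adjoin {ξ e : E} (he : e ∈ Algebra.adjoin O {ξ}) :
    ∃ c : O, ∃ r ∈ Algebra.adjoin O {ξ}, e = algebraMap O E c + ξ * r := by
  obtain ⟨p, rfl⟩ := mem_adjoin_iff.1 he
  exact ⟨_, _, mem_adjoin_iff.2 ⟨p.divX, rfl⟩, aeval_eq_add ξ p⟩

namespace IsDoublePoint

variable {ϖ : O} {ξ : E} {m δ : ℕ} {w v : O[X]} (h : IsDoublePoint ϖ ξ m δ w v)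

include h

theorem finite_adjoin : Module.Finite O (Algebra.adjoin O {ξ}) :=
  Module.Finite.iff_fg.2 h.isIntegral.fg_adjoin_singleton

/-- By `rel`, ξ^(2m+δ) is a multiple of ϖ, which lies in every maximal ideal of an integral
extension. -/
theorem mem_idealImage {B : Subalgebra O E} [Algebra.IsIntegral O B] (hB : Algebra.adjoin O {ξ} ≤ B)
    {I : Ideal B} (hI : I.IsMaximal) : ξ ∈ idealImage I := by
  have hϖ : algebraMap O E ϖ ∈ idealImage I :=
    (algebraMap_mem_idealImage hI).2 (h.span_eq ▸ Ideal.mem_span_singleton_self ϖ)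
  have hξ : ξ ∈ B := hB (Algebra.self_mem_adjoin_singleton O ξ)
  refine mem_idealImage_of_pow hI.isPrime hξ (k := 2 * m + δ) ?_
  have hw : aeval ξ w ∈ B := hB (mem_adjoin_iff.2 ⟨w, rfl⟩)
  have hv : aeval ξ v ∈ B := hB (mem_adjoin_iff.2 ⟨v, rfl⟩)
  have h1 : -(algebraMap O E ϖ * aeval ξ w + ξ ^ (m + δ) * aeval ξ v) * algebraMap O E ϖ
      ∈ idealImage I :=
    mul_mem_idealImage (neg_mem (add_mem (mul_mem (B.algebraMap_mem _) hw)
      (mul_mem (pow_mem hξ _) hv))) hϖ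
  convert h1 using 1
  linear_combination h.rel

theorem residue_mem {B : Subalgebra O E} [Algebra.IsIntegral O B] (hB : Algebra.adjoin O {ξ} ≤ B)
    {I : Ideal B} (hI : I.IsMaximal) {c : O} {r : E} (hr : r ∈ B)
    (hc : algebraMap O E c + ξ * r ∈ idealImage I) : c ∈ maximalIdeal O := by
  rw [← algebraMap_mem_idealImage hI]
  have := sub_mem hc (mul_mem_idealImage hr (h.mem_idealImage hB hI))
  convert this using 1
  ring

/-- Every maximal ideal of O[ξ] contains ξ, so an element with unit constant term avoids them all.
-/
theorem inv_mem_adjoin {c : O} {r : E} (hr : r ∈ Algebra.adjoin O {ξ})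
    (hc : c ∉ maximalIdeal O) : (algebraMap O E c + ξ * r)⁻¹ ∈ Algebra.adjoin O {ξ} := by
  have := h.finite_adjoin
  exact inv_mem_of_forall_notMem (add_mem (Subalgebra.algebraMap_mem _ _)
    (mul_mem (Algebra.self_mem_adjoin_singleton O ξ) hr))
    fun I hI h1 => hc (h.residue_mem le_rfl hI hr h1)

theorem inv_aeval_mem : (aeval ξ w)⁻¹ ∈ Algebra.adjoin O {ξ} := by
  rw [aeval_eq_add]
  refine h.inv_mem_adjoin (mem_adjoin_iff.2 ⟨_, rfl⟩) fun h1 => ?_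
  exact (mem_maximalIdeal _).1 h1 h.isUnit

theorem aeval_ne_zero : aeval ξ w ≠ 0 := by
  intro h0
  have := h.finite_adjoin
  obtain ⟨I, hI⟩ := Ideal.exists_maximal (Algebra.adjoin O {ξ})
  rw [aeval_eq_add] at h0
  exact (mem_maximalIdeal _).1 (h.residue_mem le_rfl hI (mem_adjoin_iff.2 ⟨w.divX, rfl⟩)
    (h0 ▸ zero_mem _)) h.isUnit

theorem root_ne_zero : ξ ≠ 0 := by
  intro h0
  have hm := h.pos
  have h1 : algebraMap O E ϖ ^ 2 * aeval ξ w = 0 := by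
    have h2 : ξ ^ (m + δ) = 0 := by rw [h0, zero_pow (by omega)]
    have h3 : ξ ^ (2 * m + δ) = 0 := by rw [h0, zero_pow (by omega)]
    simpa only [h2, h3, mul_zero, zero_mul, add_zero] using h.rel
  exact mul_ne_zero (pow_ne_zero 2 h.ne_zero) h.aeval_ne_zero h1

omit [IsLocalRing O] h in
/-- The element `ϖ / ξ ^ m`. -/
def slope (_ : IsDoublePoint ϖ ξ m δ w v) : E := algebraMap O E ϖ / ξ ^ m

theorem pow_mul_slope : ξ ^ m * h.slope = algebraMap O E ϖ :=
  mul_div_cancel₀ _ (pow_ne_zero _ h.root_ne_zero)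

/-- After ϖ = ξ^m t is substituted in `rel`, all three terms are divisible by ξ^(2m). -/
theorem slope_rel : h.slope ^ 2 * aeval ξ w + h.slope * ξ ^ δ * aeval ξ v + ξ ^ δ = 0 := by
  have h1 := h.rel
  rw [← h.pow_mul_slope] at h1
  refine (mul_eq_zero_iff_left (pow_ne_zero (2 * m) h.root_ne_zero)).1 ?_
  rw [← h1]
  ring

theorem slope_sq : h.slope ^ 2 = -((aeval ξ w)⁻¹ * ξ ^ δ) +
    -((aeval ξ w)⁻¹ * ξ ^ δ * aeval ξ v) * h.slope := by
  have h1 := h.slope_rel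
  have h2 := h.aeval_ne_zero
  field_simp
  linear_combination h1

theorem coeff_mem : -((aeval ξ w)⁻¹ * ξ ^ δ) ∈ Algebra.adjoin O {ξ} :=
  neg_mem (mul_mem h.inv_aeval_mem (pow_mem (Algebra.self_mem_adjoin_singleton O ξ) _))

theorem coeff_mem' : -((aeval ξ w)⁻¹ * ξ ^ δ * aeval ξ v) ∈ Algebra.adjoin O {ξ} :=
  neg_mem (mul_mem (mul_mem h.inv_aeval_mem
    (pow_mem (Algebra.self_mem_adjoin_singleton O ξ) _)) (mem_adjoin_iff.2 ⟨v, rfl⟩))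

/-- The order `O[ξ] + O[ξ] ϖ / ξ ^ m`. -/
def overorder : Subalgebra O E :=
  quadraticExtension (Algebra.adjoin O {ξ}) h.coeff_mem h.coeff_mem' h.slope_sq

theorem adjoin_le : Algebra.adjoin O {ξ} ≤ h.overorder := le_quadraticExtension _ _ _

theorem root_mem : ξ ∈ h.overorder := h.adjoin_le (Algebra.self_mem_adjoin_singleton O ξ)

theorem slope_mem : h.slope ∈ h.overorder := self_mem_quadraticExtension _ _ _

theorem finite_overorder : Module.Finite O h.overorder :=
  have := h.finite_adjoin
  finite_quadraticExtension _ _ _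

theorem aeval_mem (p : O[X]) : aeval ξ p ∈ h.overorder := h.adjoin_le (mem_adjoin_iff.2 ⟨p, rfl⟩)

theorem algebraMap_mem_powIdeal {c : O} (hc : c ∈ maximalIdeal O) :
    algebraMap O E c ∈ powIdeal h.overorder ξ m := by
  rw [h.span_eq] at hc
  obtain ⟨d, rfl⟩ := Ideal.mem_span_singleton'.1 hc
  rw [map_mul, ← h.pow_mul_slope]
  exact mul_mem_powIdeal (Subalgebra.algebraMap_mem _ _) (mem_powIdeal.2 ⟨_, h.slope_mem, rfl⟩)

/-- Only the independence of 1 and t modulo ξ depends on the ramification, so it is left as a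
hypothesis. -/
theorem isDoubleOrder (hfree : ∀ α β : O, algebraMap O E α + algebraMap O E β * h.slope ∈
      powIdeal h.overorder ξ 1 → α ∈ maximalIdeal O ∧ β ∈ maximalIdeal O) :
    IsDoubleOrder (Algebra.adjoin O {ξ}) h.overorder ξ h.slope m where
  le := h.adjoin_le
  x_ne := h.root_ne_zero
  x_mem := Algebra.self_mem_adjoin_singleton O ξ
  t_mem := h.slope_mem
  pow_mul_mem := h.pow_mul_slope ▸ Subalgebra.algebraMap_mem _ _
  maximalIdeal_le _ hc := h.algebraMap_mem_powIdeal hc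
  exists_eq_add _ he := exists_eq_add_of_mem_adjoin he
  exists_eq_add_mul _ ha := ha
  mem_maximalIdeal := hfree
  inv_mem _ _ hr hc := h.inv_mem_adjoin hr hc

theorem powIdeal_one_le {I : Ideal h.overorder} (hI : I.IsMaximal) {e : E}
    (he : e ∈ powIdeal h.overorder ξ 1) : e ∈ idealImage I := by
  have := h.finite_overorder
  obtain ⟨a, ha, rfl⟩ := mem_powIdeal.1 he
  rw [pow_one, mul_comm]
  exact mul_mem_idealImage ha (h.mem_idealImage h.adjoin_le hI)

theorem mem_powIdeal_one_of_mem {c : O} (hc : c ∈ maximalIdeal O) :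
    algebraMap O E c ∈ powIdeal h.overorder ξ 1 := by
  obtain ⟨a, ha, he⟩ := mem_powIdeal.1 (h.algebraMap_mem_powIdeal hc)
  refine mem_powIdeal.2 ⟨ξ ^ (m - 1) * a, mul_mem (pow_mem h.root_mem _) ha, ?_⟩
  rw [he, ← mul_assoc, ← pow_add, Nat.add_sub_cancel' h.pos]

theorem isDiscreteValuationRing [IsNoetherianRing O] {p : E} (hp : p ∈ h.overorder) (hp0 : p ≠ 0)
    (hmem : ∀ I : Ideal h.overorder, I.IsMaximal → p ∈ idealImage I ∧
      ∀ e ∈ idealImage I, ∃ a ∈ h.overorder, e = a * p) :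
    IsDiscreteValuationRing h.overorder := by
  have := h.finite_overorder
  have : IsNoetherianRing h.overorder := IsNoetherianRing.of_finite O _
  refine (isDiscreteValuationRing_of_isMaximal_eq_span (p := (⟨p, hp⟩ : h.overorder))
    (fun h0 => hp0 (congrArg Subtype.val h0)) fun I hI => le_antisymm (fun e he => ?_) ?_).1
  · obtain ⟨a, ha, hea⟩ := (hmem I hI).2 e (LocalOrbital.mem_idealImage.2 he)
    exact Ideal.mem_span_singleton'.2 ⟨⟨a, ha⟩, Subtype.ext hea.symm⟩
  · rw [Ideal.span_singleton_le_iff_mem]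
    exact LocalOrbital.mem_idealImage.1 (hmem I hI).1

theorem isFractionRing_overorder
    (hϖ : ∀ e : E, ∃ k : ℕ, algebraMap O E ϖ ^ k * e ∈ Algebra.adjoin O {ξ}) :
    IsFractionRing h.overorder E :=
  isFractionRing_of_exists_pow_mul_mem h.ne_zero fun e =>
    (hϖ e).imp fun _ hk => h.adjoin_le hk

theorem overorder_eq_integralClosure [IsFractionRing h.overorder E]
    [IsDiscreteValuationRing h.overorder] : h.overorder = integralClosure O E :=
  have := h.finite_overorder
  eq_integralClosure

end IsDoublePoint

end DoublePoint

/-! ### Odd degree: t is a uniformizer -/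

section Ramified

open IsLocalRing

variable {O : Type*} [CommRing O] [IsLocalRing O] {E : Type*} [Field E] [Algebra O E]
  {ϖ : O} {ξ : E} {m : ℕ} {w v : O[X]} (h : IsDoublePoint ϖ ξ m 1 w v)

namespace IsDoublePoint

include h

theorem root_eq_of_ramified :
    ξ = -(h.slope * aeval ξ w + ξ * aeval ξ v) * h.slope := by
  have h1 := h.slope_rel
  rw [pow_one] at h1
  linear_combination h1

theorem slope_mem_of_ramified {I : Ideal h.overorder} (hI : I.IsMaximal) :
    h.slope ∈ idealImage I := by
  have := h.finite_overorder
  refine mem_idealImage_of_pow hI.isPrime h.slope_mem (k := 2) ?_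
  rw [h.slope_sq, pow_one]
  have h1 : -((aeval ξ w)⁻¹ * (1 + aeval ξ v * h.slope)) * ξ ∈ idealImage I :=
    mul_mem_idealImage (neg_mem (mul_mem (h.adjoin_le h.inv_aeval_mem)
      (add_mem (one_mem _) (mul_mem (h.aeval_mem v) h.slope_mem))))
      (h.mem_idealImage h.adjoin_le hI)
  convert h1 using 1
  ring

theorem isDoubleOrder_of_ramified :
    IsDoubleOrder (Algebra.adjoin O {ξ}) h.overorder ξ h.slope m := by
  refine h.isDoubleOrder fun α β hαβ => ?_
  have := h.finite_overorder
  obtain ⟨I, hI⟩ := Ideal.exists_maximal h.overorder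
  have hα : α ∈ maximalIdeal O := by
    rw [← algebraMap_mem_idealImage hI]
    have h1 := sub_mem (h.powIdeal_one_le hI hαβ)
      (mul_mem_idealImage (h.overorder.algebraMap_mem β) (h.slope_mem_of_ramified hI))
    rwa [add_sub_cancel_right] at h1
  refine ⟨hα, fun hβ => ?_⟩
  obtain ⟨γ, hγ⟩ := hβ.exists_left_inv
  have h1 := sub_mem hαβ (h.mem_powIdeal_one_of_mem hα)
  rw [add_sub_cancel_left] at h1
  have h2 := mul_mem_powIdeal (h.overorder.algebraMap_mem γ) h1
  rw [← mul_assoc, ← map_mul, hγ, map_one, one_mul] at h2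
  obtain ⟨a, ha, hta⟩ := mem_powIdeal.1 h2
  -- Putting t = ξ a into ξ = -(t w + ξ v) t and cancelling ξ gives 1 = -ξ a (a w + v), which is the
  -- witness.
  refine one_notMem_idealImage hI (h.powIdeal_one_le hI (mem_powIdeal.2
    ⟨-(a * (a * aeval ξ w + aeval ξ v)), neg_mem (mul_mem ha (add_mem (mul_mem ha
      (h.aeval_mem w)) (h.aeval_mem v))), mul_left_cancel₀ h.root_ne_zero ?_⟩))
  have h3 := h.root_eq_of_ramified
  rw [hta] at h3
  linear_combination h3

theorem isDiscreteValuationRing_of_ramified [IsNoetherianRing O] :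
    IsDiscreteValuationRing h.overorder := by
  have := h.finite_overorder
  refine h.isDiscreteValuationRing h.slope_mem
    (div_ne_zero h.ne_zero (pow_ne_zero _ h.root_ne_zero)) fun I hI =>
    ⟨h.slope_mem_of_ramified hI, fun e he => ?_⟩
  obtain ⟨r, hr, s, hs, rfl⟩ := mem_of_mem_idealImage he
  obtain ⟨c, r', hr', rfl⟩ := exists_eq_add_of_mem_adjoin hr
  have hc : c ∈ maximalIdeal O := by
    refine h.residue_mem h.adjoin_le hI (h.adjoin_le hr') ?_
    have h1 := sub_mem he (mul_mem_idealImage (h.adjoin_le hs) (h.slope_mem_of_ramified hI))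
    rwa [add_sub_cancel_right] at h1
  obtain ⟨a, ha, hca⟩ := mem_powIdeal.1 (h.mem_powIdeal_one_of_mem hc)
  have hroot : -(h.slope * aeval ξ w + ξ * aeval ξ v) ∈ h.overorder :=
    neg_mem (add_mem (mul_mem h.slope_mem (h.aeval_mem w)) (mul_mem h.root_mem (h.aeval_mem v)))
  -- The element is ξ (a + r') + s t, and ξ is itself a multiple of t.
  refine ⟨(a + r') * -(h.slope * aeval ξ w + ξ * aeval ξ v) + s,
    add_mem (mul_mem (add_mem ha (h.adjoin_le hr')) hroot) (h.adjoin_le hs), ?_⟩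
  rw [hca]
  linear_combination (a + r') * h.root_eq_of_ramified

theorem inv_one_add_mem_of_ramified {b : E} (hb : b ∈ Algebra.adjoin O {ξ}) :
    (1 + b * h.slope)⁻¹ ∈ h.overorder := by
  refine inv_mem_of_forall_notMem (add_mem (one_mem _) (mul_mem (h.adjoin_le hb) h.slope_mem))
    fun I hI h1 => one_notMem_idealImage hI ?_
  have h2 := sub_mem h1 (mul_mem_idealImage (h.adjoin_le hb) (h.slope_mem_of_ramified hI))
  rwa [add_sub_cancel_right] at h2

theorem add_mul_ne_one_of_ramified {a b : E} (ha : a ∈ h.overorder) (hb : b ∈ h.overorder) :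
    ξ * a + h.slope * b ≠ 1 := by
  intro hab
  have := h.finite_overorder
  obtain ⟨I, hI⟩ := Ideal.exists_maximal h.overorder
  refine one_notMem_idealImage hI ?_
  rw [← hab, mul_comm ξ, mul_comm h.slope]
  exact add_mem (mul_mem_idealImage ha (h.mem_idealImage h.adjoin_le hI))
    (mul_mem_idealImage hb (h.slope_mem_of_ramified hI))

end IsDoublePoint
end Ramified

/-! ### Even degree: ξ is a uniformizer and t generates a quadratic residue extension -/

section Unramified

open IsLocalRing

variable {O : Type*} [CommRing O] [IsLocalRing O] {E : Type*} [Field E] [Algebra O E]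
  {ϖ : O} {ξ : E} {m : ℕ} {w v : O[X]} (h : IsDoublePoint ϖ ξ m 0 w v)
  (hirr : ∀ c : O, w.coeff 0 * c ^ 2 + v.coeff 0 * c + 1 ∉ maximalIdeal O)

namespace IsDoublePoint

include h hirr

/-- If β were a unit, t would be congruent modulo I to an element of O, and `slope_rel` would reduce
to a root in κ of the quadratic that `hirr` excludes. -/
theorem residues_mem_of_unramified {I : Ideal h.overorder} (hI : I.IsMaximal) {α β : O}
    (hαβ : algebraMap O E α + algebraMap O E β * h.slope ∈ idealImage I) :
    α ∈ maximalIdeal O ∧ β ∈ maximalIdeal O := by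
  have := h.finite_overorder
  have hβ : β ∈ maximalIdeal O := by
    intro hβ
    obtain ⟨γ, hγ⟩ := hβ.exists_left_inv
    have hγ' : algebraMap O E γ * algebraMap O E β = 1 := by rw [← map_mul, hγ, map_one]
    have h1 : h.slope + algebraMap O E (γ * α) ∈ idealImage I := by
      convert mul_mem_idealImage (h.overorder.algebraMap_mem γ) hαβ using 1
      rw [map_mul]
      linear_combination -h.slope * hγ'
    refine hirr (-(γ * α)) ((algebraMap_mem_idealImage hI).1 ?_)
    set c := algebraMap O E (γ * α) with hc
    have hcA : c ∈ h.overorder := h.overorder.algebraMap_mem _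
    have hξ := h.mem_idealImage h.adjoin_le hI
    have hw := mul_mem_idealImage (mul_mem (pow_mem hcA 2) (h.aeval_mem w.divX)) hξ
    have hv := mul_mem_idealImage (mul_mem hcA (h.aeval_mem v.divX)) hξ
    -- By `slope_rel`, (w (c - t) - v)(t + c) = w c² - v c + 1; `hv` and `hw` then replace v and w
    -- by their constant terms.
    have h2 : aeval ξ w * (c - h.slope) - aeval ξ v ∈ h.overorder :=
      sub_mem (mul_mem (h.aeval_mem w) (sub_mem hcA h.slope_mem)) (h.aeval_mem v)
    have h3 := mul_mem_idealImage h2 h1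
    have h4 := sub_mem (add_mem h3 hv) hw
    convert h4 using 1
    have h5 := h.slope_rel
    rw [aeval_eq_add ξ w, aeval_eq_add ξ v] at h5 ⊢
    rw [map_add, map_add, map_mul, map_mul, map_pow, map_neg, map_one, ← hc]
    linear_combination h5
  refine ⟨(algebraMap_mem_idealImage hI).1 ?_, hβ⟩
  have h1 := sub_mem hαβ (mul_mem_idealImage h.slope_mem ((algebraMap_mem_idealImage hI).2 hβ))
  convert h1 using 1
  ring

theorem residues_mem_of_unramified' {I : Ideal h.overorder} (hI : I.IsMaximal) {α β : O}
    {r s : E} (hr : r ∈ h.overorder) (hs : s ∈ h.overorder)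
    (hrs : algebraMap O E α + ξ * r + (algebraMap O E β + ξ * s) * h.slope ∈ idealImage I) :
    α ∈ maximalIdeal O ∧ β ∈ maximalIdeal O := by
  have := h.finite_overorder
  refine h.residues_mem_of_unramified hirr hI ?_
  have h1 := sub_mem hrs (mul_mem_idealImage (add_mem hr (mul_mem hs h.slope_mem))
    (h.mem_idealImage h.adjoin_le hI))
  convert h1 using 1
  ring

theorem isDoubleOrder_of_unramified :
    IsDoubleOrder (Algebra.adjoin O {ξ}) h.overorder ξ h.slope m := by
  obtain ⟨I, hI⟩ := Ideal.exists_maximal h.overorder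
  exact h.isDoubleOrder fun α β hαβ =>
    h.residues_mem_of_unramified hirr hI (h.powIdeal_one_le hI hαβ)

theorem isDiscreteValuationRing_of_unramified [IsNoetherianRing O] :
    IsDiscreteValuationRing h.overorder := by
  have := h.finite_overorder
  refine h.isDiscreteValuationRing h.root_mem h.root_ne_zero fun I hI =>
    ⟨h.mem_idealImage h.adjoin_le hI, fun e he => ?_⟩
  obtain ⟨r, hr, s, hs, rfl⟩ := mem_of_mem_idealImage he
  obtain ⟨c, r', hr', rfl⟩ := exists_eq_add_of_mem_adjoin hr
  obtain ⟨d, s', hs', rfl⟩ := exists_eq_add_of_mem_adjoin hs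
  obtain ⟨hc, hd⟩ := h.residues_mem_of_unramified' hirr hI (h.adjoin_le hr') (h.adjoin_le hs') he
  obtain ⟨a, ha, hca⟩ := mem_powIdeal.1 (h.mem_powIdeal_one_of_mem hc)
  obtain ⟨b, hb, hdb⟩ := mem_powIdeal.1 (h.mem_powIdeal_one_of_mem hd)
  refine ⟨a + r' + (b + s') * h.slope, add_mem (add_mem ha (h.adjoin_le hr'))
    (mul_mem (add_mem hb (h.adjoin_le hs')) h.slope_mem), ?_⟩
  rw [hca, hdb]
  ring

theorem inv_one_add_mem_of_unramified {b : E} (hb : b ∈ Algebra.adjoin O {ξ}) :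
    (1 + b * h.slope)⁻¹ ∈ h.overorder := by
  refine inv_mem_of_forall_notMem (add_mem (one_mem _) (mul_mem (h.adjoin_le hb) h.slope_mem))
    fun I hI h1 => ?_
  obtain ⟨d, s, hs, rfl⟩ := exists_eq_add_of_mem_adjoin hb
  have h2 := h.residues_mem_of_unramified' hirr hI (α := 1) (zero_mem _) (h.adjoin_le hs)
    (by simpa using h1)
  exact (mem_maximalIdeal 1).1 h2.1 isUnit_one

theorem inv_add_mem_of_unramified {a : E} (ha : a ∈ Algebra.adjoin O {ξ}) :
    (ξ * a + h.slope)⁻¹ ∈ h.overorder := by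
  refine inv_mem_of_forall_notMem (add_mem (mul_mem h.root_mem (h.adjoin_le ha)) h.slope_mem)
    fun I hI h1 => ?_
  have h2 := h.residues_mem_of_unramified' hirr hI (α := 0) (β := 1) (h.adjoin_le ha)
    (zero_mem _) (by simpa using h1)
  exact (mem_maximalIdeal 1).1 h2.2 isUnit_one

end IsDoublePoint
end Unramified

/-! ### The shape of φ, and the role of φ₂ -/

section Factorization

open IsLocalRing

theorem exists_eq_C_mul_add_X_pow_mul {A : Type*} [CommRing A] (a : A) (g : A[X]) (N : ℕ)
    (h : ∀ j < N, a ∣ g.coeff j) : ∃ w v : A[X], g = C a * w + X ^ N * v := by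
  induction N with
  | zero => exact ⟨0, g, by simp⟩
  | succ N ih =>
    obtain ⟨w, v, rfl⟩ := ih fun j hj => h j (by omega)
    have h1 := h N (by omega)
    rw [coeff_add, coeff_C_mul, coeff_X_pow_mul', if_pos le_rfl, Nat.sub_self,
      dvd_add_right (dvd_mul_right _ _)] at h1
    obtain ⟨b, hb⟩ := h1
    refine ⟨w + C b * X ^ N, v.divX, ?_⟩
    conv_lhs => rw [← divX_mul_X_add v, hb, C_mul]
    ring

/-- The shape of a monic polynomial whose Newton polygon has slope `2 / n`. -/
theorem exists_factorization {A : Type*} [CommRing A] [IsDomain A] [IsDiscreteValuationRing A]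
    {ϖ : A} (hϖ : Irreducible ϖ) {φ : A[X]} (hφ : φ.Monic) {m δ : ℕ}
    (hdeg : φ.natDegree = 2 * m + δ) (hδ : δ ≤ 1) (hpos : 1 ≤ m)
    (h1 : ∀ i < φ.natDegree, ϖ ∣ φ.coeff i)
    (h2 : ∀ i, 2 * i < φ.natDegree → ϖ ^ 2 ∣ φ.coeff i)
    (hord : IsDiscreteValuationRing.addVal A (φ.coeff 0) = 2) :
    ∃ w v : A[X], φ = C ϖ ^ 2 * w + C ϖ * X ^ (m + δ) * v + X ^ (2 * m + δ) ∧
      IsUnit (w.coeff 0) := by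
  have hdvd : C ϖ ∣ φ - X ^ (2 * m + δ) := by
    rw [C_dvd_iff_dvd_coeff]
    intro i
    rw [coeff_sub, coeff_X_pow]
    rcases lt_trichotomy i φ.natDegree with hi | hi | hi
    · rw [if_neg (by omega), sub_zero]
      exact h1 i hi
    · rw [if_pos (by omega), hi, hφ.coeff_natDegree, sub_self]
      exact dvd_zero _
    · rw [if_neg (by omega), coeff_eq_zero_of_natDegree_lt hi, sub_zero]
      exact dvd_zero _
  obtain ⟨g, hg⟩ := hdvd
  -- As δ ≤ 1, the condition j < m + δ is equivalent to 2j < n.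
  have hcoeff : ∀ j < m + δ, ϖ ∣ g.coeff j := by
    intro j hj
    have h3 := congrArg (fun p => coeff p j) hg
    simp only [coeff_sub, coeff_C_mul, coeff_X_pow] at h3
    rw [if_neg (by omega), sub_zero] at h3
    have h4 := h2 j (by omega)
    rwa [h3, sq, mul_dvd_mul_iff_left hϖ.ne_zero] at h4
  obtain ⟨w, v, rfl⟩ := exists_eq_C_mul_add_X_pow_mul ϖ g (m + δ) hcoeff
  have hφeq : φ = C ϖ ^ 2 * w + C ϖ * X ^ (m + δ) * v + X ^ (2 * m + δ) := by
    rw [sub_eq_iff_eq_add] at hg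
    rw [hg]
    ring
  refine ⟨w, v, hφeq, ?_⟩
  have h0 : φ.coeff 0 = ϖ ^ 2 * w.coeff 0 := by
    rw [coeff_zero_eq_eval_zero, hφeq]
    simp [coeff_zero_eq_eval_zero, show m ≠ 0 by omega]
  rw [h0, IsDiscreteValuationRing.addVal_mul, IsDiscreteValuationRing.addVal_pow,
    IsDiscreteValuationRing.addVal_uniformizer hϖ] at hord
  rw [← IsDiscreteValuationRing.addVal_eq_zero_iff]
  generalize IsDiscreteValuationRing.addVal A (w.coeff 0) = a at hord
  induction a using ENat.recTopCoe with
  | top => simp at hord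
  | coe a =>
    simp only [nsmul_eq_mul] at hord
    norm_cast at hord ⊢
    omega

theorem mul_exactQuotient {A : Type*} [CommRing A] {a b : A} (h : a ∣ b) :
    a * exactQuotient b a = b := by
  rw [exactQuotient, dif_pos h]
  exact h.choose_spec.symm

variable {F : Type*} [Field F] [ValuativeRel F] [TopologicalSpace F]
  [IsNonarchimedeanLocalField F]

/-- The quadratic is the reciprocal of φ₂: a root γ in κ is nonzero because the constant term is 1,
and γ⁻¹ is then a root of φ₂. -/
theorem residue_quadratic_notMem {ϖ : 𝒪[F]} (hϖ : Irreducible ϖ) {φ w v : 𝒪[F][X]} {m : ℕ}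
    (hpos : 1 ≤ m) (hdeg : φ.natDegree = 2 * m)
    (hφ : φ = C ϖ ^ 2 * w + C ϖ * X ^ m * v + X ^ (2 * m)) (hirr : Irreducible (phiTwo ϖ φ))
    (c : 𝒪[F]) : w.coeff 0 * c ^ 2 + v.coeff 0 * c + 1 ∉ maximalIdeal 𝒪[F] := by
  have h0 : φ.coeff 0 = ϖ ^ 2 * w.coeff 0 := by
    rw [coeff_zero_eq_eval_zero, hφ]
    simp [coeff_zero_eq_eval_zero, show m ≠ 0 by omega]
  have hm : φ.coeff m = ϖ * (ϖ * w.coeff m + v.coeff 0) := by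
    rw [hφ, ← C_pow, mul_assoc, coeff_add, coeff_add, coeff_C_mul, coeff_C_mul, coeff_X_pow_mul',
      if_pos le_rfl, Nat.sub_self, coeff_X_pow, if_neg (by omega)]
    ring
  have hq0 : exactQuotient (φ.coeff 0) (ϖ ^ 2) = w.coeff 0 :=
    mul_left_cancel₀ (pow_ne_zero 2 hϖ.ne_zero)
      ((mul_exactQuotient (h0 ▸ dvd_mul_right _ _)).trans h0)
  have hqm : exactQuotient (φ.coeff m) ϖ = ϖ * w.coeff m + v.coeff 0 :=
    mul_left_cancel₀ hϖ.ne_zero ((mul_exactQuotient (hm ▸ dvd_mul_right _ _)).trans hm)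
  have hϖ0 : residue 𝒪[F] ϖ = 0 := by
    rw [residue_eq_zero_iff]
    exact hϖ.not_isUnit
  have hphi : phiTwo ϖ φ = C 1 * X ^ 2 + C (residue 𝒪[F] (v.coeff 0)) * X
      + C (residue 𝒪[F] (w.coeff 0)) := by
    rw [phiTwo, hq0, hdeg, Nat.mul_div_cancel_left m two_pos, show 2 * m - m = m by omega, hqm,
      map_add, map_mul, hϖ0, zero_mul, zero_add, C_1, one_mul]
  intro hc
  rw [← residue_eq_zero_iff, map_add, map_add, map_mul, map_mul, map_pow, map_one] at hc
  set γ := residue 𝒪[F] c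
  have hγ : γ ≠ 0 := by
    intro hγ
    simp [hγ] at hc
  have hroot : (phiTwo ϖ φ).IsRoot γ⁻¹ := by
    rw [hphi, IsRoot.def]
    simp only [eval_add, eval_mul, eval_C, eval_pow, eval_X]
    field_simp
    linear_combination hc
  have h3 := degree_eq_one_of_irreducible_of_root hirr hroot
  rw [hphi, degree_quadratic one_ne_zero] at h3
  exact absurd h3 (by norm_num)

end Factorization

/-! ### Finiteness of the Serre invariant -/

section Finiteness

open IsLocalRing

/-- A finitely generated module over a discrete valuation ring which is killed by a power of the
uniformizer has finite length. -/
theorem length_ne_top_of_pow_smul_eq_zero {O : Type*} [CommRing O] [IsDomain O]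
    [IsDiscreteValuationRing O] {M : Type*} [AddCommGroup M] [Module O M] [Module.Finite O M]
    (k : ℕ) (h : ∀ c ∈ maximalIdeal O ^ k, ∀ x : M, c • x = 0) : Module.length O M ≠ ⊤ := by
  obtain ⟨g, f, hf⟩ := Module.Finite.exists_fin' O M
  let π : (Fin g → O) →ₗ[O] (Fin g → O ⧸ maximalIdeal O ^ k) :=
    (Submodule.mkQ (maximalIdeal O ^ k)).compLeft (Fin g)
  have hπ : Function.Surjective π := fun y =>
    ⟨fun i => (Submodule.mkQ_surjective _ (y i)).choose,
      funext fun i => (Submodule.mkQ_surjective _ (y i)).choose_spec⟩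
  have hker : LinearMap.ker π ≤ LinearMap.ker f := by
    intro c hc
    rw [LinearMap.mem_ker] at hc ⊢
    rw [pi_eq_sum_univ c, map_sum]
    refine Finset.sum_eq_zero fun i _ => ?_
    rw [map_smul]
    refine h _ ?_ _
    have h1 := congrFun hc i
    exact (Submodule.Quotient.mk_eq_zero _).1 h1
  have hs : Function.Surjective ((LinearMap.ker π).liftQ f hker) := fun y => by
    obtain ⟨c, rfl⟩ := hf y
    exact ⟨Submodule.Quotient.mk c, rfl⟩
  refine ne_top_of_le_ne_top ?_ (Module.length_le_of_surjective _ hs)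
  rw [(π.quotKerEquivOfSurjective hπ).length_eq, Module.length_pi_of_fintype]
  simp only [IsDiscreteValuationRing.length_quotient_pow_maximalIdeal]
  rw [Finset.sum_const, nsmul_eq_mul]
  norm_cast
  exact ENat.natCast_ne_top _

variable {F : Type*} [Field F] [ValuativeRel F] [TopologicalSpace F]
  [IsNonarchimedeanLocalField F] {E : Type*} [Field E] [Algebra F E]

theorem exists_pow_mul_mem {ϖ : 𝒪[F]} (hϖ : Irreducible ϖ) {R : Subalgebra 𝒪[F] E}
    (hspan : Submodule.span F (R : Set E) = ⊤) (e : E) :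
    ∃ k : ℕ, algebraMap 𝒪[F] E ϖ ^ k * e ∈ R := by
  -- Every scalar of F has a power of ϖ as denominator.
  have hF : ∀ c : F, ∃ k : ℕ, ∃ d : 𝒪[F], algebraMap 𝒪[F] F ϖ ^ k * c = algebraMap 𝒪[F] F d := by
    intro c
    by_cases hc : c = 0
    · exact ⟨0, 0, by simp [hc]⟩
    · obtain ⟨j, u, rfl⟩ := IsDiscreteValuationRing.exists_units_eq_smul_zpow_of_irreducible hϖ hc
      have h0 : algebraMap 𝒪[F] F ϖ ≠ 0 := by
        rw [map_ne_zero_iff _ (IsFractionRing.injective 𝒪[F] F)]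
        exact hϖ.ne_zero
      obtain ⟨n, hn⟩ := Int.eq_ofNat_of_zero_le (by omega : 0 ≤ (j.natAbs : ℤ) + j)
      refine ⟨j.natAbs, u * ϖ ^ n, ?_⟩
      rw [Units.smul_def, Algebra.smul_def, mul_left_comm, ← zpow_natCast, ← zpow_add₀ h0, hn,
        zpow_natCast, map_mul, map_pow]
  have he : e ∈ Submodule.span F (R : Set E) := hspan ▸ Submodule.mem_top
  induction he using Submodule.span_induction with
  | mem y hy => exact ⟨0, by simpa using hy⟩
  | zero => exact ⟨0, by simp⟩
  | add y z _ _ hy hz =>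
    obtain ⟨k, hk⟩ := hy
    obtain ⟨l, hl⟩ := hz
    refine ⟨k + l, ?_⟩
    have h1 := add_mem (mul_mem (pow_mem (R.algebraMap_mem ϖ) l) hk)
      (mul_mem (pow_mem (R.algebraMap_mem ϖ) k) hl)
    convert h1 using 1
    ring
  | smul c y _ hy =>
    obtain ⟨k, hk⟩ := hy
    obtain ⟨l, d, hd⟩ := hF c
    refine ⟨l + k, ?_⟩
    have h1 := mul_mem (R.algebraMap_mem d) hk
    convert h1 using 1
    rw [IsScalarTower.algebraMap_apply 𝒪[F] F E d, ← hd, Algebra.smul_def, map_mul, map_pow,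
      ← IsScalarTower.algebraMap_apply 𝒪[F] F E]
    ring

/-- Separability makes 𝒪_E finite over 𝔬, so one power of ϖ carries it into R. This covers even n
with φ₂ reducible, where no evaluation of S(R) is made. -/
theorem serreInvariant_ne_top [FiniteDimensional F E] [Algebra.IsSeparable F E] {ϖ : 𝒪[F]}
    (hϖ : Irreducible ϖ) {R : Subalgebra 𝒪[F] E} (hspan : Submodule.span F (R : Set E) = ⊤) :
    serreInvariant R ≠ ⊤ := by
  have hfin : Module.Finite 𝒪[F] (integralClosure 𝒪[F] E) :=
    IsIntegralClosure.finite 𝒪[F] F E _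
  have hfin' : Module.Finite 𝒪[F] (Subalgebra.toSubmodule (integralClosure 𝒪[F] E)) := hfin
  have hkill : ∃ k : ℕ, ∀ e ∈ integralClosure 𝒪[F] E, algebraMap 𝒪[F] E ϖ ^ k * e ∈ R := by
    have hfg : (Subalgebra.toSubmodule (integralClosure 𝒪[F] E)).FG := Module.Finite.iff_fg.1 hfin
    obtain ⟨s, hs⟩ := hfg
    choose k hk using exists_pow_mul_mem (E := E) hϖ hspan
    refine ⟨s.sup k, fun e he => ?_⟩
    rw [← Subalgebra.mem_toSubmodule, ← hs] at he
    induction he using Submodule.span_induction with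
    | mem y hy =>
      obtain ⟨l, hl⟩ := Nat.exists_eq_add_of_le' (Finset.le_sup (f := k) hy)
      rw [hl, pow_add, mul_assoc]
      exact mul_mem (pow_mem (R.algebraMap_mem ϖ) l) (hk y)
    | zero => simp
    | add y z _ _ hy hz => rw [mul_add]; exact add_mem hy hz
    | smul c y _ hy => rw [mul_smul_comm]; exact R.smul_mem hy c
  obtain ⟨k, hk⟩ := hkill
  refine length_ne_top_of_pow_smul_eq_zero k fun c hc x => ?_
  obtain ⟨⟨e, he⟩, rfl⟩ := Submodule.Quotient.mk_surjective _ x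
  rw [hϖ.maximalIdeal_eq, Ideal.span_singleton_pow] at hc
  obtain ⟨d, rfl⟩ := Ideal.mem_span_singleton'.1 hc
  rw [← Submodule.Quotient.mk_smul, Submodule.Quotient.mk_eq_zero]
  change (d * ϖ ^ k) • e ∈ R
  rw [Algebra.smul_def, map_mul, map_pow, mul_assoc]
  exact mul_mem (R.algebraMap_mem d) (hk e he)

omit [TopologicalSpace F] [IsNonarchimedeanLocalField F] in
theorem isSeparable_of_root [FiniteDimensional F E] {φ : 𝒪[F][X]} (hφ : φ.Monic)
    (hirr : Irreducible φ) (hdeg : 0 < φ.natDegree)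
    (hchar : ringChar F = 0 ∨ φ.natDegree < ringChar F) {ξ : E} (hξ : aeval ξ φ = 0)
    (hspan : Submodule.span F (Algebra.adjoin 𝒪[F] {ξ} : Set E) = ⊤) :
    Algebra.IsSeparable F E := by
  have hirr' : Irreducible (φ.map (algebraMap 𝒪[F] F)) :=
    (hφ.irreducible_iff_irreducible_map_fraction_map).1 hirr
  have hsep : (φ.map (algebraMap 𝒪[F] F)).Separable := by
    rw [separable_iff_derivative_ne_zero hirr']
    intro h0
    -- The derivative has leading coefficient n, nonzero in F when the characteristic is 0 or
    -- exceeds n.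
    have h1 := congrArg (fun p => coeff p (φ.natDegree - 1)) h0
    simp only [coeff_derivative, coeff_zero, coeff_map] at h1
    rw [Nat.sub_add_cancel hdeg, hφ.coeff_natDegree, map_one, one_mul, ← Nat.cast_succ,
      Nat.succ_eq_add_one, Nat.sub_add_cancel hdeg, ringChar.spec] at h1
    rcases hchar with h2 | h2
    · rw [h2, zero_dvd_iff] at h1
      omega
    · exact absurd (Nat.le_of_dvd hdeg h1) (by omega)
  have hξsep : IsSeparable F ξ := by
    refine Polynomial.Separable.of_dvd hsep (minpoly.dvd F ξ ?_)
    rwa [aeval_map_algebraMap]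
  have htop : IntermediateField.adjoin F {ξ} = ⊤ := by
    refine eq_top_iff.2 fun e _ => ?_
    have he : e ∈ Submodule.span F (Algebra.adjoin 𝒪[F] {ξ} : Set E) := hspan ▸ Submodule.mem_top
    induction he using Submodule.span_induction with
    | mem y hy =>
      obtain ⟨p, rfl⟩ := mem_adjoin_iff.1 hy
      rw [← aeval_map_algebraMap F]
      exact IntermediateField.algebra_adjoin_le_adjoin F {ξ}
        (Algebra.adjoin_singleton_eq_range_aeval F ξ ▸ ⟨_, rfl⟩)
    | zero => exact zero_mem _
    | add y z _ _ hy hz => exact add_mem (hy trivial) (hz trivial)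
    | smul c y _ hy => exact IntermediateField.smul_mem _ (hy trivial)
  rw [← IntermediateField.isSeparable_adjoin_simple_iff_isSeparable, htop] at hξsep
  exact AlgEquiv.Algebra.isSeparable IntermediateField.topEquiv

end Finiteness

/-! ### Evaluation in the two cases -/

section Evaluation

variable {F : Type*} [Field F] [ValuativeRel F] [TopologicalSpace F]
  [IsNonarchimedeanLocalField F] {E : Type*} [Field E] [Algebra F E]

/-- A copy of `A[X] / (φ)` inside `E` is generated by a root of `φ`. -/
theorem exists_root_of_algEquiv {A : Type*} [CommRing A] [Algebra A E] {φ : A[X]}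
    {R : Subalgebra A E} (e : R ≃ₐ[A] AdjoinRoot φ) :
    ∃ ξ : E, aeval ξ φ = 0 ∧ R = Algebra.adjoin A {ξ} := by
  have hmk : ∀ p : A[X], aeval ((e.symm (AdjoinRoot.root φ) : R) : E) p =
      (e.symm (AdjoinRoot.mk φ p) : R) := by
    intro p
    rw [← AdjoinRoot.aeval_eq, ← R.coe_val]
    change aeval (R.val (e.symm.toAlgHom (AdjoinRoot.root φ))) p =
      R.val (e.symm.toAlgHom (aeval (AdjoinRoot.root φ) p))
    rw [aeval_algHom_apply, aeval_algHom_apply]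
  refine ⟨(e.symm (AdjoinRoot.root φ) : R), ?_, le_antisymm (fun r hr => ?_) ?_⟩
  · rw [hmk, AdjoinRoot.mk_self, map_zero, ZeroMemClass.coe_zero]
  · obtain ⟨p, hp⟩ := AdjoinRoot.mk_surjective (e ⟨r, hr⟩)
    refine mem_adjoin_iff.2 ⟨p, ?_⟩
    rw [hmk, hp, AlgEquiv.symm_apply_apply]
  · rw [Algebra.adjoin_le_iff, Set.singleton_subset_iff]
    exact Subtype.mem _

theorem isDoublePoint_of_factorization {ϖ : 𝒪[F]} (hϖ : Irreducible ϖ) {φ w v : 𝒪[F][X]}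
    (hφ : φ.Monic) {m δ : ℕ} (hpos : 1 ≤ m)
    (hfac : φ = C ϖ ^ 2 * w + C ϖ * X ^ (m + δ) * v + X ^ (2 * m + δ))
    (hw : IsUnit (w.coeff 0)) {ξ : E} (hξ : aeval ξ φ = 0) : IsDoublePoint ϖ ξ m δ w v where
  span_eq := hϖ.maximalIdeal_eq
  ne_zero := by
    rw [IsScalarTower.algebraMap_apply 𝒪[F] F E, _root_.map_ne_zero,
      map_ne_zero_iff _ (IsFractionRing.injective 𝒪[F] F)]
    exact hϖ.ne_zero
  isIntegral := ⟨φ, hφ, hξ⟩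
  isUnit := hw
  pos := hpos
  rel := by
    rw [hfac] at hξ
    simpa using hξ

namespace IsDoublePoint

variable {ϖ : 𝒪[F]} {ξ : E} {m δ : ℕ} {w v : 𝒪[F][X]} (h : IsDoublePoint ϖ ξ m δ w v)

include h

theorem isFractionRing_of_span (hϖ : Irreducible ϖ)
    (hspan : Submodule.span F (Algebra.adjoin 𝒪[F] {ξ} : Set E) = ⊤) :
    IsFractionRing h.overorder E :=
  h.isFractionRing_overorder (exists_pow_mul_mem hϖ hspan)

theorem isUniformizerOf_overorder [IsFractionRing h.overorder E]
    [IsDiscreteValuationRing h.overorder] {πE : Eˣ} (hπE : IsUniformizer F πE) :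
    IsUniformizerOf h.overorder πE := by
  have heq := h.overorder_eq_integralClosure
  rw [IsUniformizer, ← heq] at hπE
  obtain ⟨p, hp, hpE⟩ := hπE
  exact isUniformizerOf_of_irreducible hp hpE

theorem serreInvariant_eq [IsFractionRing h.overorder E] [IsDiscreteValuationRing h.overorder]
    {t : E} (hd : IsDoubleOrder (Algebra.adjoin 𝒪[F] {ξ}) h.overorder ξ t m) :
    serreInvariant (Algebra.adjoin 𝒪[F] {ξ}) = m := by
  rw [serreInvariant, ← h.overorder_eq_integralClosure]
  exact hd.length_quotient

end IsDoublePoint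

theorem evaluation_of_ramified {ϖ : 𝒪[F]} (hϖ : Irreducible ϖ) {ξ : E} {m : ℕ} {w v : 𝒪[F][X]}
    (h : IsDoublePoint ϖ ξ m 1 w v)
    (hspan : Submodule.span F (Algebra.adjoin 𝒪[F] {ξ} : Set E) = ⊤) {πE : Eˣ}
    (hπE : IsUniformizer F πE) :
    serreInvariant (Algebra.adjoin 𝒪[F] {ξ}) = m ∧
      orbitalIntegral (Algebra.adjoin 𝒪[F] {ξ}) πE =
        ∑ i ∈ Finset.range (m + 1), residueCard F ^ i := by
  have := h.isFractionRing_of_span hϖ hspan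
  have := h.isDiscreteValuationRing_of_ramified
  have hd := h.isDoubleOrder_of_ramified
  exact ⟨h.serreInvariant_eq hd, hd.orbitalIntegral_of_nonunit h.pos
    (h.isUniformizerOf_overorder hπE) hspan (fun b hb => h.inv_one_add_mem_of_ramified hb)
    fun a ha b hb => h.add_mul_ne_one_of_ramified ha hb⟩

theorem evaluation_of_unramified {ϖ : 𝒪[F]} (hϖ : Irreducible ϖ) {ξ : E} {m : ℕ} {w v : 𝒪[F][X]}
    (h : IsDoublePoint ϖ ξ m 0 w v)
    (hirr : ∀ c : 𝒪[F], w.coeff 0 * c ^ 2 + v.coeff 0 * c + 1 ∉ IsLocalRing.maximalIdeal 𝒪[F])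
    (hspan : Submodule.span F (Algebra.adjoin 𝒪[F] {ξ} : Set E) = ⊤) {πE : Eˣ}
    (hπE : IsUniformizer F πE) :
    serreInvariant (Algebra.adjoin 𝒪[F] {ξ}) = m ∧
      orbitalIntegral (Algebra.adjoin 𝒪[F] {ξ}) πE =
        ∑ i ∈ Finset.range (m + 1), residueCard F ^ i +
          ∑ i ∈ Finset.range m, residueCard F ^ i := by
  have := h.isFractionRing_of_span hϖ hspan
  have := h.isDiscreteValuationRing_of_unramified hirr
  have hd := h.isDoubleOrder_of_unramified hirr
  exact ⟨h.serreInvariant_eq hd, hd.orbitalIntegral_of_unit h.pos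
    (h.isUniformizerOf_overorder hπE) hspan (fun b hb => h.inv_one_add_mem_of_unramified hirr hb)
    fun a ha => h.inv_add_mem_of_unramified hirr ha⟩

theorem sum_zpow_sub (q : ℚ) (m : ℕ) :
    ∑ i ∈ Finset.range (m + 1), q ^ ((m : ℤ) - (i : ℤ)) = ∑ i ∈ Finset.range (m + 1), q ^ i := by
  rw [← Finset.sum_range_reflect]
  refine Finset.sum_congr rfl fun i hi => ?_
  rw [← zpow_natCast]
  congr 1
  have := Finset.mem_range.1 hi
  omega

theorem sum_zpow_sub_Icc (q : ℚ) (m : ℕ) :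
    ∑ i ∈ Finset.Icc 1 m, q ^ ((m : ℤ) - (i : ℤ)) = ∑ i ∈ Finset.range m, q ^ i := by
  rw [← Finset.Ico_add_one_right_eq_Icc, Finset.sum_Ico_eq_sum_range, Nat.add_sub_cancel,
    ← Finset.sum_range_reflect]
  refine Finset.sum_congr rfl fun i hi => ?_
  rw [← zpow_natCast]
  congr 1
  have := Finset.mem_range.1 hi
  omega

end Evaluation

end LocalOrbital

end

theorem mainTheorem4
    {F : Type*} [Field F] [ValuativeRel F] [TopologicalSpace F] [IsNonarchimedeanLocalField F]
    {E : Type*} [Field E] [Algebra F E] [FiniteDimensional F E]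
    (ϖ : 𝒪[F]) (hϖ : Irreducible ϖ)
    (πE : Eˣ) (hπE : LocalOrbital.IsUniformizer F πE)
    (φ : 𝒪[F][X]) (hmonic : φ.Monic) (hirr : Irreducible φ)
    (hdeg : 4 ≤ φ.natDegree)
    (hord : IsDiscreteValuationRing.addVal 𝒪[F] (φ.eval 0) = 2)
    (hchar : ringChar F = 0 ∨ φ.natDegree < ringChar F)
    (R : Subalgebra 𝒪[F] E) (hspan : Submodule.span F (R : Set E) = ⊤)
    (hR : Nonempty (R ≃ₐ[𝒪[F]] AdjoinRoot φ)) :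
    ∃ S : ℕ, LocalOrbital.serreInvariant R = S ∧
      (∀ m : ℕ, φ.natDegree = 2 * m + 1 →
        (LocalOrbital.orbitalIntegral R πE : ℚ) =
          ∑ i ∈ Finset.range (m + 1),
            (LocalOrbital.residueCard F : ℚ) ^ ((S : ℤ) - (i : ℤ))) ∧
      (∀ m : ℕ, φ.natDegree = 2 * m → Irreducible (LocalOrbital.phiTwo ϖ φ) →
        (LocalOrbital.orbitalIntegral R πE : ℚ) =
          (LocalOrbital.residueCard F : ℚ) ^ (S : ℤ) +
            2 * ∑ i ∈ Finset.Icc 1 m,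
              (LocalOrbital.residueCard F : ℚ) ^ ((S : ℤ) - (i : ℤ))) := by
  rw [← coeff_zero_eq_eval_zero] at hord
  have hnewton := LocalOrbital.uniformizer_dvd_coeff hϖ φ hmonic hirr hord
  obtain ⟨e⟩ := hR
  obtain ⟨ξ, hξ, rfl⟩ := LocalOrbital.exists_root_of_algEquiv e
  have hsep : Algebra.IsSeparable F E :=
    LocalOrbital.isSeparable_of_root hmonic hirr (by omega) hchar hξ hspan
  -- `S` is fixed before the parity of n is known; each case then identifies it with m.
  obtain ⟨S, hS⟩ := ENat.ne_top_iff_exists.1 (LocalOrbital.serreInvariant_ne_top hϖ hspan)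
  refine ⟨S, hS.symm, fun m hm => ?_, fun m hm hphi => ?_⟩
  · obtain ⟨w, v, hfac, hw⟩ := LocalOrbital.exists_factorization hϖ hmonic hm le_rfl (by omega)
      (fun i hi => (hnewton i hi).1) (fun i hi => (hnewton i (by omega)).2 hi) hord
    obtain ⟨hSm, hcard⟩ := LocalOrbital.evaluation_of_ramified hϖ
      (LocalOrbital.isDoublePoint_of_factorization hϖ hmonic (by omega) hfac hw hξ) hspan hπE
    obtain rfl : S = m := by exact_mod_cast hS.trans hSm
    rw [hcard, LocalOrbital.sum_zpow_sub]
    push_cast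
    rfl
  · obtain ⟨w, v, hfac, hw⟩ := LocalOrbital.exists_factorization (δ := 0) hϖ hmonic hm zero_le_one (by omega)
      (fun i hi => (hnewton i hi).1) (fun i hi => (hnewton i (by omega)).2 hi) hord
    obtain ⟨hSm, hcard⟩ := LocalOrbital.evaluation_of_unramified hϖ
      (LocalOrbital.isDoublePoint_of_factorization hϖ hmonic (by omega) hfac hw hξ)
      (LocalOrbital.residue_quadratic_notMem hϖ (by omega) hm hfac hphi) hspan hπE
    obtain rfl : S = m := by exact_mod_cast hS.trans hSm
    -- The two families overlap in all levels but the top: Σ_{i≤m} q^i + Σ_{i<m} q^i = q^m + 2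
    -- Σ_{i<m} q^i.
    rw [hcard, LocalOrbital.sum_zpow_sub_Icc, Finset.sum_range_succ, zpow_natCast]
    push_cast
    ring
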